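/- **Parameter space.** Let $U=\{[a,b,c,d]\in\mathbb P^3 : abcd\neq 0,\ ad-bc\neq 0\}$. For a field $K\supseteq\mathbb Q$ and $[a,b,c,d]\in U(K)$ let $X_{a,b,c,d}$ be the Châtelet surface over $K$, that is the proper smooth model $$y^2+z^2=w^2(au^2+bv^2)(cu^2+dv^2),\qquad (u,v)\neq(0,0),\ (y,z,w)\neq(0,0,0),$$ of the affine surface $Y^2+Z^2=(aT^2+b)(cT^2+d)$. Let $\mathcal M$ be the quotient of $U(\mathbb Q)$ by the group generated by the maps $$[a,b,c,d]\mapsto[\lambda^2N(\xi)a,\ \mu^2N(\xi)b,\ \lambda^2N(\eta)c,\ \mu^2N(\eta)d]\qquad(\lambda,\mu\in\mathbb Q^*,\ \xi,\eta\in\mathbb Q(i)^*),$$ where $N$ is the norm from $\mathbb Q(i)$ to $\mathbb Q$, together with $[a,b,c,d]\mapsto[c,d,a,b]$ and $[a,b,c,d]\mapsto[b,a,d,c]$. All points of a class give isomorphic surfaces over $\mathbb{Q}$. Let $\mathcal M_{\mathrm{loc}}\subset\mathcal M$ be the set of classes for which $X_{a,b,c,d}(\mathbb Q_v)\neq\emptyset$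 for every place $v$ of $\mathbb Q$ (with $\mathbb{Q}_\infty=\mathbb{R}$). **Counting function.** Call $(a,b,c,d)\in\mathbb Z^4$ reduced if $a>0$, $bcd(ad-bc)\neq0$, $\gcd(a,b,c,d)=1$, the integers $\gcd(a,c)$ and $\gcd(b,d)$ are squarefree, and $\gcd(a,b)$ and $\gcd(c,d)$ are squarefree with all prime factors $\equiv3\bmod 4$. For $P\geq1$ let $$N_{\mathrm{loc}}(P)=\sum_{u\in\mathcal M_{\mathrm{loc}}}\tfrac14\,\#\{(a,b,c,d)\text{ reduced}:\ [a,b,c,d]\in u,\ \max(|a|,|b|,|c|,|d|)\leq P\},$$ i.e. one quarter of the number of reduced quadruples of height at most $P$ whose surface is everywhere locally soluble. **Local densities.** For a prime $p$ put $\delta_p=1$ if $p\equiv3\bmod4$ and $\delta_p=0$ otherwise, and let $D_p$ be the set of $(a,b,c,d)\in\mathbb Z_p^4\setminus p\mathbb Z_p^4$ with $abcd(ad-bc)\neq0$, $X_{a,b,c,d}(\mathbb Q_p)\neq\emptyset$, and $$\min\{v_p(a),v_p(c)\}\leq1,\quad \min\{v_p(b),v_p(d)\}\leq1,\quad \min\{v_p(a),v_p(b)\}\leq\delta_p,\quad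 \min\{v_p(c),v_p(d)\}\leq\delta_p.$$ Put $$\tau_{\mathrm{loc},p}=\lim_{k\to\infty}p^{-4k}\,\#\bigl(\text{image of }D_p\text{ in }(\mathbb Z/p^k\mathbb Z)^4\bigr),$$ $$\tau_{\mathrm{loc},\infty}=\tfrac18\operatorname{vol}\{(a,b,c,d)\in[-1,1]^4:\ abcd(ad-bc)\neq0,\ X_{a,b,c,d}(\mathbb R)\neq\emptyset\}.$$ **Theorem.** The limits $\tau_{\mathrm{loc},p}$ exist, $\tau_{\mathrm{loc},\infty}=7/4$, the product $\tau_{\mathrm{loc}}=\tau_{\mathrm{loc},\infty}\prod_p\tau_{\mathrm{loc},p}$ converges, and for every $\varepsilon>0$ there is a constant $C_\varepsilon$ such that for all $P\geq1$ $$\bigl|N_{\mathrm{loc}}(P)-\tau_{\mathrm{loc}}P^4\bigr|\leq C_\varepsilon P^{4-1/8+\varepsilon}.$$ -/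

import Mathlib

open Filter Topology MeasureTheory

noncomputable section

namespace Chatelet

/-- The conditions `abcd ≠ 0` and `ad - bc ≠ 0` on a coefficient vector `x = (a, b, c, d)`. -/
def Nondegenerate {R : Type*} [CommRing R] (x : Fin 4 → R) : Prop :=
  x 0 * x 1 * x 2 * x 3 ≠ 0 ∧ x 0 * x 3 - x 1 * x 2 ≠ 0

/-- The Châtelet surface `X_{a,b,c,d}` has a `K`-point. The surface is the proper smooth model
`y² + z² = w² (a u² + b v²) (c u² + d v²)` of `Y² + Z² = (a T² + b) (c T² + d)`: a conic bundle
over `ℙ¹` whose points are given by `(u, v) ≠ 0` and `(y, z, w) ≠ 0`, up to rescaling. The affine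
surface is the part `v = w = 1`. -/
def HasPoint (K : Type*) [Field K] (x : Fin 4 → K) : Prop :=
  ∃ u v y z w : K, (u ≠ 0 ∨ v ≠ 0) ∧ (y ≠ 0 ∨ z ≠ 0 ∨ w ≠ 0) ∧
    y ^ 2 + z ^ 2 = w ^ 2 * ((x 0 * u ^ 2 + x 1 * v ^ 2) * (x 2 * u ^ 2 + x 3 * v ^ 2))

/-- The surface with rational coefficients `x` has points over every completion of `ℚ`. -/
def EverywhereLocallySoluble (x : Fin 4 → ℚ) : Prop :=
  HasPoint ℝ (fun i => (x i : ℝ)) ∧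
    ∀ (p : ℕ) [Fact p.Prime], HasPoint ℚ_[p] (fun i => (x i : ℚ_[p]))

/-- Coordinate vectors of the rational points of `U ⊂ ℙ³`. Proportional vectors are identified
in `Params` below, by the factor `t` of `Step.torus`. -/
abbrev Coeffs : Type := {x : Fin 4 → ℚ // Nondegenerate x}

/-- Two vectors that differ by a homogeneous rescaling `t` and an element of
`𝔾ₘ(ℚ)² × ℚ(i)ˣ × ℚ(i)ˣ`, or by one of the two involutions that generate the factor
`(ℤ/2)²` of `G`. -/
inductive Step : Coeffs → Coeffs → Prop
  | torus (x y : Coeffs) (t l m ξ₁ ξ₂ η₁ η₂ : ℚ)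
      (h : y.1 = ![t * l ^ 2 * (ξ₁ ^ 2 + ξ₂ ^ 2) * x.1 0, t * m ^ 2 * (ξ₁ ^ 2 + ξ₂ ^ 2) * x.1 1,
        t * l ^ 2 * (η₁ ^ 2 + η₂ ^ 2) * x.1 2, t * m ^ 2 * (η₁ ^ 2 + η₂ ^ 2) * x.1 3]) : Step x y
  | swapFactors (x y : Coeffs) (h : y.1 = ![x.1 2, x.1 3, x.1 0, x.1 1]) : Step x y
  | swapVariables (x y : Coeffs) (h : y.1 = ![x.1 1, x.1 0, x.1 3, x.1 2]) : Step x y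

/-- The set `ℳ = U(ℚ) / G(ℚ)`. -/
def Params : Type := Quot Step

/-- The set `ℳ_loc` of the classes whose surface is everywhere locally soluble. -/
def ParamsLoc : Set Params :=
  {u | ∃ y : Coeffs, Quot.mk Step y = u ∧ EverywhereLocallySoluble y.1}

/-- A squarefree positive integer all of whose prime factors are `3` modulo `4`. -/
def SquarefreeThreeModFour (n : ℕ) : Prop :=
  Squarefree n ∧ ∀ p : ℕ, p.Prime → p ∣ n → p % 4 = 3

/-- The reduced representatives: primitive integral vectors, with sign fixed by `a > 0`, such that
`gcd(a,c)`, `gcd(b,d)` are squarefree and `gcd(a,b)`, `gcd(c,d)` are squarefree with all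
prime factors `3` modulo `4`. -/
structure IsReduced (x : Fin 4 → ℤ) : Prop where
  pos : 0 < x 0
  nondegenerate : Nondegenerate x
  primitive : Nat.gcd (Int.gcd (x 0) (x 1)) (Int.gcd (x 2) (x 3)) = 1
  gcd_ac : Squarefree (Int.gcd (x 0) (x 2))
  gcd_bd : Squarefree (Int.gcd (x 1) (x 3))
  gcd_ab : SquarefreeThreeModFour (Int.gcd (x 0) (x 1))
  gcd_cd : SquarefreeThreeModFour (Int.gcd (x 2) (x 3))

/-- The reduced representatives of the class `u` whose naive height is at most `P`; the naive height
of a primitive integral vector is the maximum of the `|x i|`. -/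
def reducedReps (u : Params) (P : ℝ) : Set (Fin 4 → ℤ) :=
  {x | IsReduced x ∧ (∃ y : Coeffs, Quot.mk Step y = u ∧ ∀ i, y.1 i = (x i : ℚ)) ∧
    ∀ i, |(x i : ℝ)| ≤ P}

/-- `N_loc(P)`: the classes of `ℳ_loc`, each counted with weight `1/4` for every reduced
representative of height at most `P`. -/
def Nloc (P : ℝ) : ℝ :=
  ∑ᶠ u ∈ ParamsLoc, ((reducedReps u P).ncard : ℝ) / 4

/-- `δ_p`, which is `1` if `p` is `3` modulo `4` and `0` otherwise. -/
def delta (p : ℕ) : ℕ := if p % 4 = 3 then 1 else 0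

/-- The vectors `(a, b, c, d)` in `ℤ_p⁴ ∖ p ℤ_p⁴` whose surface has a `ℚ_p`-point and with
`min(v(a), v(c)) ≤ 1`, `min(v(b), v(d)) ≤ 1`, `min(v(a), v(b)) ≤ δ_p`, `min(v(c), v(d)) ≤ δ_p`. -/
def padicSoluble (p : ℕ) [Fact p.Prime] : Set (Fin 4 → ℤ_[p]) :=
  {x | Nondegenerate x ∧ HasPoint ℚ_[p] (fun i => (x i : ℚ_[p])) ∧
    (∃ i, ¬ (p : ℤ_[p]) ∣ x i) ∧
    ¬ ((p : ℤ_[p]) ^ 2 ∣ x 0 ∧ (p : ℤ_[p]) ^ 2 ∣ x 2) ∧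
    ¬ ((p : ℤ_[p]) ^ 2 ∣ x 1 ∧ (p : ℤ_[p]) ^ 2 ∣ x 3) ∧
    ¬ ((p : ℤ_[p]) ^ (delta p + 1) ∣ x 0 ∧ (p : ℤ_[p]) ^ (delta p + 1) ∣ x 1) ∧
    ¬ ((p : ℤ_[p]) ^ (delta p + 1) ∣ x 2 ∧ (p : ℤ_[p]) ^ (delta p + 1) ∣ x 3)}

/-- The proportion of the vectors in `(ℤ/p^k)⁴` that lift to an element of `padicSoluble p`. -/
def padicProportion (p : ℕ) [Fact p.Prime] (k : ℕ) : ℝ :=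
  (((fun (x : Fin 4 → ℤ_[p]) (i : Fin 4) => PadicInt.toZModPow k (x i)) ''
    padicSoluble p).ncard : ℝ) / (p : ℝ) ^ (4 * k)

/-- `τ_{loc,p}`, for a prime `p`. -/
def tauPrime (p : ℕ) [Fact p.Prime] : ℝ :=
  limUnder atTop (padicProportion p)

/-- `τ_{loc,∞}`: the volume of the vectors in `[-1,1]⁴` whose surface has real points, divided by
`8 = 2 · 4` for the identifications under `±1` and under `(ℤ/2)²`. -/
def tauInfinity : ℝ :=
  (volume {x : Fin 4 → ℝ | (∀ i, |x i| ≤ 1) ∧ Nondegenerate x ∧ HasPoint ℝ x}).toReal / 8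

/-- `τ_loc`, the product of the `τ_{loc,v}` over all places `v` of `ℚ`. -/
def tauLoc : ℝ :=
  tauInfinity * ∏' p : Nat.Primes, (haveI : Fact (p : ℕ).Prime := ⟨p.2⟩; tauPrime (p : ℕ))

end Chatelet

end

/-! Solubility of the surface depends only on its class (`everywhereLocallySoluble_of_step`), so
`Nloc P` is a quarter of the number of reduced, everywhere locally soluble vectors of height at most
`P` (`Nloc_eq`). The reducedness conditions on gcds are local too. Thus one counts integral vectors
with a condition at every prime in each of the seven orthants with `a > 0` that are allowed at the
real place.

The tool is a sieve over moduli. A nondegenerate vector outside `padicSoluble p` has a unique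
exponent `k` such that it lifts to `padicSoluble p` modulo `p ^ (k - 1)` but not modulo `p ^ k`. For
a modulus `q`, let `failSet q` be the vectors whose failure exponent at each prime `p ∣ q` is the
exponent of `p` in `q`. Then the indicator of solubility at all primes is the sum over `q` of `(-1)
^ ω(q)` times the indicator of `failSet q` (`hasSum_failSet`). Each `failSet q` is periodic modulo
`q`, with a density multiplicative in `q`. The densities at powers of `p` telescope to `1 - τ_p`, so
the signed Euler product is `∏ τ_p` (`hasProd_tauPrime`).

Convergence and uniformity come from the arithmetic of the surfaces. Solubility is stable under
changing the coefficients by factors `p`-adically close to `1` (`HasPoint.perturb`), and for odd `p`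
it is automatic unless two coefficients are divisible by `p` (`exists_two_dvd`). Hence a first
failure modulo `p ^ k` forces divisibilities of total strength `p ^ max k 2`, up to a constant at
`2`. Therefore both the density of `failSet q` and its nondegenerate counts in boxes are bounded by
`weight q`, resp. `weight q * N ^ 4` (`count_failSet_le`), and `∑ weight q * q ^ (1/4)` converges.
Equidistribution modulo `q` is used for `q ≤ P ^ (1/2)` and the uniform bound for larger `q`, where
`q ^ (1/4)` gains `P ^ (1/8)`. This is the exponent in the error term. -/

namespace Chatelet

/-! ### Squares in `ℚ_p` and stability of local solubility -/

section Local

variable {p : ℕ} [Fact p.Prime]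

lemma norm_two_pos : 0 < ‖(2 : ℚ_[p])‖ := norm_pos_iff.2 two_ne_zero

lemma norm_two_le_one : ‖(2 : ℚ_[p])‖ ≤ 1 := by
  simpa using Padic.norm_int_le_one (p := p) 2

/-- An element of `ℚ_[p]` that is close to `1` is the square of a nonzero element. -/
lemma exists_sq_eq_of_norm_sub_one_lt {s : ℚ_[p]} (h : ‖s - 1‖ < ‖(2 : ℚ_[p])‖ ^ 2) :
    ∃ t : ℚ_[p], t ≠ 0 ∧ t ^ 2 = s := by
  have h1 : ‖s - 1‖ < 1 := h.trans_le (pow_le_one₀ (norm_nonneg _) norm_two_le_one)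
  have hs : ‖s‖ ≤ 1 := by
    have := Padic.nonarchimedean (s - 1) 1
    rw [sub_add_cancel] at this
    exact this.trans (max_le h1.le (by simp))
  obtain ⟨s', rfl⟩ : ∃ s' : ℤ_[p], (s' : ℚ_[p]) = s := ⟨⟨s, hs⟩, rfl⟩
  -- Hensel's condition for `X ^ 2 - s` at the approximate root `1`, where the derivative is `2`.
  have key : ‖(Polynomial.X ^ 2 - Polynomial.C s' : Polynomial ℤ_[p]).aeval (1 : ℤ_[p])‖ <
      ‖(Polynomial.X ^ 2 - Polynomial.C s' : Polynomial ℤ_[p]).derivative.aeval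
        (1 : ℤ_[p])‖ ^ 2 := by
    rw [norm_sub_rev, ← one_add_one_eq_two] at h
    simpa [PadicInt.norm_def] using h
  obtain ⟨z, hz, -⟩ := hensels_lemma key
  have hz2 : (z : ℚ_[p]) ^ 2 = s' := by
    have : z ^ 2 = s' := by simpa [sub_eq_zero] using hz
    have := congrArg (fun w : ℤ_[p] => (w : ℚ_[p])) this
    simpa using this
  refine ⟨z, fun h0 => ?_, hz2⟩
  rw [h0] at hz2
  rw [← hz2] at h1
  norm_num at h1

/-- Strong cancellation means that `-d v² / (c u²)` is close to `1`, hence a square, so the form is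
already isotropic. The factors `s`, `s'` are squares themselves and can be absorbed into the
variables. -/
lemma exists_diagonal_zero {c d u v s s' : ℚ_[p]} (hs : ‖s - 1‖ < ‖(2 : ℚ_[p])‖ ^ 2)
    (hs' : ‖s' - 1‖ < ‖(2 : ℚ_[p])‖ ^ 2)
    (h : ‖c * u ^ 2 + d * v ^ 2‖ < ‖(2 : ℚ_[p])‖ ^ 2 * ‖c * u ^ 2‖) :
    ∃ U V : ℚ_[p], (U ≠ 0 ∨ V ≠ 0) ∧ s * c * U ^ 2 + s' * d * V ^ 2 = 0 := by
  have hcu : c * u ^ 2 ≠ 0 := by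
    intro h0
    rw [h0] at h
    simp only [norm_zero, mul_zero] at h
    exact absurd h (not_lt.2 (norm_nonneg _))
  have hr : ‖-(d * v ^ 2) / (c * u ^ 2) - 1‖ < ‖(2 : ℚ_[p])‖ ^ 2 := by
    rw [show -(d * v ^ 2) / (c * u ^ 2) - 1 = -((c * u ^ 2 + d * v ^ 2) / (c * u ^ 2)) by
      rw [add_div, div_self hcu, neg_div]; ring, norm_neg, norm_div,
      div_lt_iff₀ (norm_pos_iff.2 hcu)]
    exact h
  obtain ⟨t, ht, htr⟩ := exists_sq_eq_of_norm_sub_one_lt hr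
  obtain ⟨σ, hσ, hσs⟩ := exists_sq_eq_of_norm_sub_one_lt hs
  obtain ⟨σ', hσ', hσs'⟩ := exists_sq_eq_of_norm_sub_one_lt hs'
  rw [eq_div_iff hcu] at htr
  have hu : u ≠ 0 := by rintro rfl; simp at hcu
  refine ⟨u * t / σ, v / σ', Or.inl (div_ne_zero (mul_ne_zero hu ht) hσ), ?_⟩
  rw [← hσs, ← hσs']
  field_simp
  linear_combination htr

/-- Perturbing the coefficients of a diagonal binary form by factors close to `1` either gives an
isotropic form or changes a given value by a square. -/
lemma diagonal_perturb {c d u v s s' : ℚ_[p]} (hc : c ≠ 0) (hd : d ≠ 0) (huv : u ≠ 0 ∨ v ≠ 0)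
    (hs : ‖s - 1‖ < ‖(2 : ℚ_[p])‖ ^ 4) (hs' : ‖s' - 1‖ < ‖(2 : ℚ_[p])‖ ^ 4) :
    (∃ U V : ℚ_[p], (U ≠ 0 ∨ V ≠ 0) ∧ s * c * U ^ 2 + s' * d * V ^ 2 = 0) ∨
    ∃ t : ℚ_[p], t ≠ 0 ∧ s * c * u ^ 2 + s' * d * v ^ 2 = t ^ 2 * (c * u ^ 2 + d * v ^ 2) := by
  have h2 : 0 < ‖(2 : ℚ_[p])‖ := norm_two_pos
  have h42 : ‖(2 : ℚ_[p])‖ ^ 4 ≤ ‖(2 : ℚ_[p])‖ ^ 2 :=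
    pow_le_pow_of_le_one h2.le norm_two_le_one (by norm_num)
  by_cases h₁ : ‖c * u ^ 2 + d * v ^ 2‖ < ‖(2 : ℚ_[p])‖ ^ 2 * ‖c * u ^ 2‖
  · exact Or.inl (exists_diagonal_zero (hs.trans_le h42) (hs'.trans_le h42) h₁)
  by_cases h₂ : ‖c * u ^ 2 + d * v ^ 2‖ < ‖(2 : ℚ_[p])‖ ^ 2 * ‖d * v ^ 2‖
  · rw [add_comm] at h₂
    obtain ⟨V, U, h, h'⟩ := exists_diagonal_zero (hs'.trans_le h42) (hs.trans_le h42) h₂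
    exact Or.inl ⟨U, V, h.symm, by rw [add_comm]; exact h'⟩
  -- Without strong cancellation the value loses at most `‖2‖ ^ 2` against its larger term. Together
  -- with the `‖2‖ ^ 2` needed for square roots this accounts for the exponent `4` in the
  -- hypotheses.
  right
  rw [not_lt] at h₁ h₂
  have hM : 0 < max ‖c * u ^ 2‖ ‖d * v ^ 2‖ := by
    rcases huv with h | h
    · exact lt_max_of_lt_left (norm_pos_iff.2 (mul_ne_zero hc (pow_ne_zero 2 h)))
    · exact lt_max_of_lt_right (norm_pos_iff.2 (mul_ne_zero hd (pow_ne_zero 2 h)))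
  have hg : ‖(2 : ℚ_[p])‖ ^ 2 * max ‖c * u ^ 2‖ ‖d * v ^ 2‖ ≤ ‖c * u ^ 2 + d * v ^ 2‖ := by
    rcases max_choice ‖c * u ^ 2‖ ‖d * v ^ 2‖ with h | h <;> rw [h] <;> assumption
  have hg0 : 0 < ‖c * u ^ 2 + d * v ^ 2‖ := lt_of_lt_of_le (by positivity) hg
  have hdiff : ‖(s - 1) * (c * u ^ 2) + (s' - 1) * (d * v ^ 2)‖ <
      ‖(2 : ℚ_[p])‖ ^ 2 * ‖c * u ^ 2 + d * v ^ 2‖ := by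
    refine (Padic.nonarchimedean _ _).trans_lt ?_
    have aux : ∀ t e : ℚ_[p], ‖t‖ < ‖(2 : ℚ_[p])‖ ^ 4 → ‖e‖ ≤ max ‖c * u ^ 2‖ ‖d * v ^ 2‖ →
        ‖t * e‖ < ‖(2 : ℚ_[p])‖ ^ 2 * ‖c * u ^ 2 + d * v ^ 2‖ := by
      intro t e ht he
      calc ‖t * e‖ = ‖t‖ * ‖e‖ := norm_mul _ _
        _ ≤ ‖t‖ * max ‖c * u ^ 2‖ ‖d * v ^ 2‖ := by gcongr
        _ < ‖(2 : ℚ_[p])‖ ^ 4 * max ‖c * u ^ 2‖ ‖d * v ^ 2‖ := by gcongr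
        _ = ‖(2 : ℚ_[p])‖ ^ 2 * (‖(2 : ℚ_[p])‖ ^ 2 * max ‖c * u ^ 2‖ ‖d * v ^ 2‖) := by ring
        _ ≤ _ := by gcongr
    exact max_lt (aux _ _ hs (le_max_left _ _)) (aux _ _ hs' (le_max_right _ _))
  have hq : ‖(s * c * u ^ 2 + s' * d * v ^ 2) / (c * u ^ 2 + d * v ^ 2) - 1‖ <
      ‖(2 : ℚ_[p])‖ ^ 2 := by
    have h0 : c * u ^ 2 + d * v ^ 2 ≠ 0 := norm_pos_iff.1 hg0
    rw [show (s * c * u ^ 2 + s' * d * v ^ 2) / (c * u ^ 2 + d * v ^ 2) - 1 =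
      ((s - 1) * (c * u ^ 2) + (s' - 1) * (d * v ^ 2)) / (c * u ^ 2 + d * v ^ 2) by
        field_simp; ring, norm_div, div_lt_iff₀ hg0]
    exact hdiff
  obtain ⟨t, ht, h⟩ := exists_sq_eq_of_norm_sub_one_lt hq
  exact ⟨t, ht, by rw [h, div_mul_cancel₀ _ (norm_pos_iff.1 hg0)]⟩

lemma hasPoint_of_isotropic_left {K : Type*} [Field K] {x : Fin 4 → K} {u v : K}
    (huv : u ≠ 0 ∨ v ≠ 0) (h : x 0 * u ^ 2 + x 1 * v ^ 2 = 0) : HasPoint K x :=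
  ⟨u, v, 0, 0, 1, huv, by simp, by simp [h]⟩

lemma hasPoint_of_isotropic_right {K : Type*} [Field K] {x : Fin 4 → K} {u v : K}
    (huv : u ≠ 0 ∨ v ≠ 0) (h : x 2 * u ^ 2 + x 3 * v ^ 2 = 0) : HasPoint K x :=
  ⟨u, v, 0, 0, 1, huv, by simp, by simp [h]⟩

/-- Solubility at `p` is stable under perturbing the coefficients by factors close to `1`. -/
lemma HasPoint.perturb {x s : Fin 4 → ℚ_[p]} (hx : ∀ i, x i ≠ 0)
    (hs : ∀ i, ‖s i - 1‖ < ‖(2 : ℚ_[p])‖ ^ 4) (h : HasPoint ℚ_[p] x) :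
    HasPoint ℚ_[p] (fun i => s i * x i) := by
  obtain ⟨u, v, y, z, w, huv, hyzw, heq⟩ := h
  -- A zero of either quadratic factor gives a point with `y = z = 0`, `w = 1`; otherwise both
  -- values change by squares, which rescale `y` and `z`.
  rcases diagonal_perturb (hx 0) (hx 1) huv (hs 0) (hs 1) with ⟨U, V, hUV, h0⟩ | ⟨t, ht, hf⟩
  · exact hasPoint_of_isotropic_left hUV h0
  rcases diagonal_perturb (hx 2) (hx 3) huv (hs 2) (hs 3) with ⟨U, V, hUV, h0⟩ | ⟨t', ht', hg⟩
  · exact hasPoint_of_isotropic_right hUV h0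
  refine ⟨u, v, t * t' * y, t * t' * z, w, huv, ?_, ?_⟩
  · simpa [ht, ht'] using hyzw
  · rw [hf, hg]
    linear_combination (t * t') ^ 2 * heq

lemma norm_two_eq_one (hp : p ≠ 2) : ‖(2 : ℚ_[p])‖ = 1 := by
  have := Padic.norm_natCast_eq_one_iff (p := p) (n := 2)
  rw [Nat.cast_ofNat] at this
  exact this.2 ((Nat.coprime_primes Fact.out Nat.prime_two).2 hp)

/-- For odd `p` an integer prime to `p` is a sum of two `p`-adic squares. -/
lemma exists_sq_add_sq_eq (hp : p ≠ 2) {a : ℤ} (ha : ¬ (p : ℤ) ∣ a) :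
    ∃ y z : ℚ_[p], y ^ 2 + z ^ 2 = a := by
  -- A solution modulo `p` in which `A` is a unit lifts: `(a - B²) / A²` is close to `1`, hence a
  -- square.
  have aux : ∀ A B : ℤ, (p : ℤ) ∣ a - (A ^ 2 + B ^ 2) → ¬ (p : ℤ) ∣ A →
      ∃ y z : ℚ_[p], y ^ 2 + z ^ 2 = a := by
    intro A B hAB hA
    have hA1 : ‖(A : ℚ_[p])‖ = 1 :=
      le_antisymm (Padic.norm_int_le_one A) (not_lt.1 (Padic.norm_intCast_lt_one_iff.not.2 hA))
    have hA0 : (A : ℚ_[p]) ≠ 0 := norm_pos_iff.1 (by rw [hA1]; exact one_pos)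
    have h : ‖((a : ℚ_[p]) - B ^ 2) / A ^ 2 - 1‖ < ‖(2 : ℚ_[p])‖ ^ 2 := by
      have h' := Padic.norm_intCast_lt_one_iff.2 hAB
      rw [show ((a : ℚ_[p]) - B ^ 2) / A ^ 2 - 1 =
        ((a - (A ^ 2 + B ^ 2) : ℤ) : ℚ_[p]) / A ^ 2 by push_cast; field_simp; ring,
        norm_div, norm_pow, hA1, norm_two_eq_one hp]
      simpa using h'
    obtain ⟨t, -, ht⟩ := exists_sq_eq_of_norm_sub_one_lt h
    refine ⟨A * t, B, ?_⟩
    rw [mul_pow, ht]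
    field_simp
    ring
  obtain ⟨A, B, -, -, h⟩ := Nat.sq_add_sq_zmodEq p a
  have h' : (p : ℤ) ∣ a - ((A : ℤ) ^ 2 + (B : ℤ) ^ 2) := h.dvd
  by_cases hA : (p : ℤ) ∣ (A : ℤ)
  · refine aux B A (by rwa [add_comm]) fun hB => ha ?_
    have := dvd_add h' (dvd_add (dvd_pow hA two_ne_zero) (dvd_pow hB two_ne_zero))
    rwa [sub_add_cancel] at this
  · exact aux A B h' hA

end Local

/-! ### Lifting modulo prime powers and the first failure -/

/-- The integral vector `x` is congruent modulo `p ^ k` to an element of `padicSoluble p`. -/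
def Lifts (p k : ℕ) (x : Fin 4 → ℤ) : Prop :=
  ∃ _ : Fact p.Prime, ∃ y ∈ padicSoluble p, ∀ i, (p : ℤ_[p]) ^ k ∣ y i - x i

/-- The exponent `k` is the least one for which `x` modulo `p ^ k` does not lift to
`padicSoluble p`. -/
def FailsAt (p k : ℕ) (x : Fin 4 → ℤ) : Prop := Lifts p (k - 1) x ∧ ¬ Lifts p k x

lemma Nondegenerate.ne_zero {R : Type*} [CommRing R] {x : Fin 4 → R} (h : Nondegenerate x)
    (i : Fin 4) : x i ≠ 0 := by
  intro h0
  apply h.1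
  fin_cases i <;> simp_all

lemma Nondegenerate.map {R S : Type*} [CommRing R] [CommRing S] {x : Fin 4 → R}
    (h : Nondegenerate x) (f : R →+* S) (hf : Function.Injective f) :
    Nondegenerate (fun i => f (x i)) := by
  refine ⟨?_, ?_⟩
  · simpa only [← map_mul, ne_eq, map_eq_zero_iff f hf] using h.1
  · simpa only [← map_mul, ← map_sub, ne_eq, map_eq_zero_iff f hf] using h.2

lemma Nondegenerate.intCast {R : Type*} [CommRing R] [CharZero R] {x : Fin 4 → ℤ}
    (h : Nondegenerate x) : Nondegenerate (fun i => (x i : R)) :=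
  h.map (Int.castRingHom R) Int.cast_injective

section

variable {p : ℕ} [hp : Fact p.Prime]

lemma lifts_of_mem {x : Fin 4 → ℤ} (h : (fun i => (x i : ℤ_[p])) ∈ padicSoluble p) (k : ℕ) :
    Lifts p k x := ⟨hp, _, h, fun i => by simp⟩

lemma Lifts.mono {p k l : ℕ} {x : Fin 4 → ℤ} (h : Lifts p k x) (hl : l ≤ k) : Lifts p l x := by
  obtain ⟨h, y, hy, hd⟩ := h
  exact ⟨h, y, hy, fun i => (pow_dvd_pow _ hl).trans (hd i)⟩

lemma Lifts.congr {p k : ℕ} {x x' : Fin 4 → ℤ} (h : Lifts p k x)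
    (hx : ∀ i, (p : ℤ) ^ k ∣ x i - x' i) : Lifts p k x' := by
  obtain ⟨h, y, hy, hd⟩ := h
  refine ⟨h, y, hy, fun i => ?_⟩
  have h1 : (p : ℤ_[p]) ^ k ∣ (x i : ℤ_[p]) - x' i := by
    have := map_dvd (Int.castRingHom ℤ_[p]) (hx i)
    simpa using this
  have := dvd_add (hd i) h1
  rwa [sub_add_sub_cancel] at this

/-- Nonemptiness makes every vector lift modulo `p ^ 0`, so that failure exponents are positive and
the first proportion is `1`. -/
lemma padicSoluble_nonempty : (padicSoluble p).Nonempty := by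
  refine ⟨![1, 1, 1, 2], ?_⟩
  have h1 : ∀ n : ℕ, n ≠ 0 → ¬ (p : ℤ_[p]) ^ n ∣ 1 := fun n hn h => by
    have := (isUnit_of_dvd_one ((dvd_pow_self _ hn).trans h))
    exact (PadicInt.prime_p (p := p)).not_isUnit this
  refine ⟨⟨by simp, ?_⟩, ?_, ⟨0, ?_⟩, ?_, ?_, ?_, ?_⟩
  · simp only [Matrix.cons_val]; norm_num
  · refine ⟨1, 0, 1, 0, 1, by simp, by simp, by simp⟩
  · simpa using h1 1
  · simpa using h1 2
  · exact fun h => h1 2 two_ne_zero (by simpa using h.1)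
  · exact fun h => h1 _ (Nat.succ_ne_zero _) (by simpa using h.1)
  · exact fun h => h1 _ (Nat.succ_ne_zero _) (by simpa using h.1)

lemma lifts_zero (x : Fin 4 → ℤ) : Lifts p 0 x := by
  obtain ⟨y, hy⟩ := padicSoluble_nonempty (p := p)
  exact ⟨hp, y, hy, fun i => by simp⟩

/-- The number of further `p`-adic digits, beyond the leading one of each coefficient, that
determine solubility at `p` (plus one). -/
def digits (p : ℕ) : ℕ := if p = 2 then 5 else 1

lemma digits_bound : (p : ℝ) ^ (1 - (digits p : ℤ)) ≤ ‖(2 : ℚ_[p])‖ ^ 4 := by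
  unfold digits
  split_ifs with h
  · subst h
    have := Padic.norm_p (p := 2)
    rw [Nat.cast_ofNat] at this
    rw [this]
    norm_num
  · rw [norm_two_eq_one h]; simp

lemma one_le_digits (p : ℕ) : 1 ≤ digits p := by unfold digits; split_ifs <;> norm_num

/-- If no coefficient is too divisible by `p`, a congruence modulo `p ^ k` makes each quotient `x i
/ y i` close enough to `1` for `HasPoint.perturb`. The remaining conditions involve divisibility by
at most `p ^ 2`, so they only need `2 ≤ k`. -/
lemma mem_padicSoluble_of_lifts {k : ℕ} {x : Fin 4 → ℤ} (hx : Nondegenerate x)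
    (h : Lifts p k x) (hk : 2 ≤ k) (hv : ∀ i, ¬ (p : ℤ) ^ (k + 1 - digits p) ∣ x i) :
    (fun i => (x i : ℤ_[p])) ∈ padicSoluble p := by
  obtain ⟨_, y, ⟨hnd, hpt, h1, h2, h3, h4, h5⟩, hd⟩ := h
  have hp0 : (0 : ℝ) < p := by exact_mod_cast hp.out.pos
  have hp1 : (1 : ℝ) ≤ p := by exact_mod_cast hp.out.one_le
  have hdig := one_le_digits p
  have key : ∀ i, ‖(x i : ℚ_[p]) / (y i : ℚ_[p]) - 1‖ < ‖(2 : ℚ_[p])‖ ^ 4 := by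
    intro i
    have hn : digits p ≤ k := by
      by_contra hcon
      have : k + 1 - digits p = 0 := by omega
      exact hv i (by simp [this])
    have hxn : (p : ℝ) ^ (-((k + 1 - digits p : ℕ) : ℤ)) < ‖(x i : ℚ_[p])‖ := by
      rw [← not_le, Padic.norm_int_le_pow_iff_dvd]
      exact_mod_cast hv i
    have hxy : ‖(y i : ℚ_[p]) - x i‖ ≤ (p : ℝ) ^ (-(k : ℤ)) := by
      have := (PadicInt.norm_le_pow_iff_mem_span_pow (y i - (x i : ℤ_[p])) k).2
        (Ideal.mem_span_singleton.2 (hd i))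
      rw [PadicInt.norm_def] at this
      simpa using this
    have hlt : ‖(y i : ℚ_[p]) - x i‖ < ‖(x i : ℚ_[p])‖ := by
      refine hxy.trans_lt (lt_of_le_of_lt ?_ hxn)
      apply zpow_le_zpow_right₀ hp1
      omega
    have hyx : ‖(y i : ℚ_[p])‖ = ‖(x i : ℚ_[p])‖ := by
      have := IsUltrametricDist.norm_add_eq_max_of_norm_ne_norm hlt.ne
      rwa [sub_add_cancel, max_eq_right hlt.le] at this
    have hx0 : 0 < ‖(x i : ℚ_[p])‖ := (norm_nonneg _).trans_lt hlt
    have hy0 : (y i : ℚ_[p]) ≠ 0 := norm_pos_iff.1 (hyx ▸ hx0)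
    rw [show (x i : ℚ_[p]) / (y i : ℚ_[p]) - 1 = -((y i - x i) / (y i : ℚ_[p])) by
      field_simp; ring, norm_neg, norm_div, hyx, div_lt_iff₀ hx0]
    calc ‖(y i : ℚ_[p]) - x i‖ ≤ (p : ℝ) ^ (-(k : ℤ)) := hxy
      _ = (p : ℝ) ^ (1 - (digits p : ℤ)) * (p : ℝ) ^ (-((k + 1 - digits p : ℕ) : ℤ)) := by
        rw [← zpow_add₀ hp0.ne']; congr 1; omega
      _ < (p : ℝ) ^ (1 - (digits p : ℤ)) * ‖(x i : ℚ_[p])‖ := by gcongr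
      _ ≤ _ := by gcongr; exact digits_bound
  have hiff : ∀ (j : ℕ) (i : Fin 4), j ≤ 2 → ((p : ℤ_[p]) ^ j ∣ (x i : ℤ_[p]) ↔
      (p : ℤ_[p]) ^ j ∣ y i) := fun j i hj =>
    (dvd_iff_dvd_of_dvd_sub ((pow_dvd_pow _ (hj.trans hk)).trans (hd i))).symm
  have hdel : delta p + 1 ≤ 2 := by unfold delta; split_ifs <;> norm_num
  have hy0 : ∀ i, (y i : ℚ_[p]) ≠ 0 := fun i => by
    rw [ne_eq, PadicInt.coe_eq_zero]; exact hnd.ne_zero i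
  refine ⟨hx.intCast, ?_, ?_, ?_, ?_, ?_, ?_⟩
  · have := hpt.perturb hy0 key
    simpa [div_mul_cancel₀ _ (hy0 _)] using this
  · obtain ⟨i, hi⟩ := h1
    exact ⟨i, by have := hiff 1 i (by norm_num); rw [pow_one] at this; rwa [this]⟩
  · rwa [hiff 2 _ le_rfl, hiff 2 _ le_rfl]
  · rwa [hiff 2 _ le_rfl, hiff 2 _ le_rfl]
  · rwa [hiff _ _ hdel, hiff _ _ hdel]
  · rwa [hiff _ _ hdel, hiff _ _ hdel]

lemma intCast_pow_dvd_iff {n : ℕ} {a : ℤ} : (p : ℤ_[p]) ^ n ∣ (a : ℤ_[p]) ↔ (p : ℤ) ^ n ∣ a := by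
  have := PadicInt.pow_p_dvd_int_iff (p := p) n a
  exact_mod_cast this

/-- For odd `p`, a vector outside `padicSoluble p` has two coefficients divisible by `p`. -/
lemma exists_two_dvd (hp2 : p ≠ 2) {x : Fin 4 → ℤ} (hx : Nondegenerate x)
    (h : (fun i => (x i : ℤ_[p])) ∉ padicSoluble p) :
    ∃ i j, i ≠ j ∧ (p : ℤ) ∣ x i ∧ (p : ℤ) ∣ x j := by
  by_contra! hcon
  have hpow : ∀ i j (n : ℕ), i ≠ j → n ≠ 0 →
      ¬ ((p : ℤ_[p]) ^ n ∣ (x i : ℤ_[p]) ∧ (p : ℤ_[p]) ^ n ∣ (x j : ℤ_[p])) := by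
    intro i j n hij hn ⟨h1, h2⟩
    rw [intCast_pow_dvd_iff] at h1 h2
    exact hcon i j hij ((dvd_pow_self _ hn).trans h1) ((dvd_pow_self _ hn).trans h2)
  refine h ⟨hx.intCast, ?_, ?_, hpow _ _ _ (by decide) (by norm_num),
    hpow _ _ _ (by decide) (by norm_num), hpow _ _ _ (by decide) (by norm_num),
    hpow _ _ _ (by decide) (by norm_num)⟩
  · have hprime : Prime (p : ℤ) := Nat.prime_iff_prime_int.1 hp.out
    -- With at most one coefficient divisible by `p`, one of `ac`, `bd` is prime to `p`, hence a sum
    -- of two squares. This gives a point above `v = 0` or `u = 0`.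
    by_cases h02 : (p : ℤ) ∣ x 0 * x 2
    · have h13 : ¬ (p : ℤ) ∣ x 1 * x 3 := by
        intro h13
        rcases hprime.dvd_or_dvd h02 with h | h <;> rcases hprime.dvd_or_dvd h13 with h' | h' <;>
          exact hcon _ _ (by decide) h h'
      obtain ⟨y, z, hyz⟩ := exists_sq_add_sq_eq hp2 h13
      exact ⟨0, 1, y, z, 1, by simp, by simp, by simp [hyz]⟩
    · obtain ⟨y, z, hyz⟩ := exists_sq_add_sq_eq hp2 h02
      exact ⟨1, 0, y, z, 1, by simp, by simp, by simp [hyz]⟩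
  · by_contra! hall
    have := hpow 0 1 1 (by decide) one_ne_zero
    simp only [pow_one] at this
    exact this ⟨hall 0, hall 1⟩

lemma FailsAt.notMem {k : ℕ} {x : Fin 4 → ℤ} (h : FailsAt p k x) :
    (fun i => (x i : ℤ_[p])) ∉ padicSoluble p := fun hm => h.2 (lifts_of_mem hm k)

lemma FailsAt.exists_pow_dvd {k : ℕ} {x : Fin 4 → ℤ} (h : FailsAt p k x) (hx : Nondegenerate x)
    (hk : 3 ≤ k) : ∃ i, (p : ℤ) ^ (k - digits p) ∣ x i := by
  by_contra! hcon
  refine h.notMem (mem_padicSoluble_of_lifts hx h.1 (by omega) ?_)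
  rwa [show k - 1 + 1 - digits p = k - digits p by omega]

/-- Two sources are combined: failure gives two coefficients divisible by `p`, and for `3 ≤ k`
stability gives one divisible by `p ^ (k - 1)`. Whichever coefficient the latter is, a different one
divisible by `p` remains. -/
lemma FailsAt.exists_dvd_of_odd {k : ℕ} {x : Fin 4 → ℤ} (h : FailsAt p k x)
    (hx : Nondegenerate x) (hp2 : p ≠ 2) :
    ∃ i j, i ≠ j ∧ (p : ℤ) ^ max (k - 1) 1 ∣ x i ∧ (p : ℤ) ∣ x j := by
  obtain ⟨i, j, hij, hi, hj⟩ := exists_two_dvd hp2 hx h.notMem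
  by_cases hk : 3 ≤ k
  · obtain ⟨l, hl⟩ := h.exists_pow_dvd hx hk
    rw [digits, if_neg hp2] at hl
    rw [max_eq_left (by omega)]
    by_cases hli : l = i
    · exact ⟨l, j, hli ▸ hij, hl, hj⟩
    · exact ⟨l, i, hli, hl, hi⟩
  · rw [max_eq_right (by omega), pow_one]
    exact ⟨i, j, hij, hi, hj⟩

lemma FailsAt.exists_dvd_two {k : ℕ} {x : Fin 4 → ℤ} (h : FailsAt 2 k x)
    (hx : Nondegenerate x) : ∃ i, (2 : ℤ) ^ (k - 5) ∣ x i := by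
  by_cases hk : 3 ≤ k
  · obtain ⟨l, hl⟩ := h.exists_pow_dvd hx hk
    exact ⟨l, by simpa [digits] using hl⟩
  · exact ⟨0, by rw [show k - 5 = 0 by omega]; simp⟩

lemma FailsAt.unique {k l : ℕ} {x : Fin 4 → ℤ} (h : FailsAt p k x) (h' : FailsAt p l x) :
    k = l := by
  by_contra hne
  have hk : k ≠ 0 := by rintro rfl; exact h.2 (lifts_zero x)
  have hl : l ≠ 0 := by rintro rfl; exact h'.2 (lifts_zero x)
  rcases lt_or_gt_of_ne hne with hlt | hlt
  · exact h.2 (h'.1.mono (by omega))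
  · exact h'.2 (h.1.mono (by omega))

lemma FailsAt.pos {k : ℕ} {x : Fin 4 → ℤ} (h : FailsAt p k x) : 0 < k := by
  rcases Nat.eq_zero_or_pos k with rfl | hk
  · exact absurd (lifts_zero x) h.2
  · exact hk

/-- The coefficients are nonzero, so for large `k` none is divisible by the power of `p` in
`mem_padicSoluble_of_lifts`, and lifting modulo `p ^ k` would imply membership. The least
non-lifting exponent is the required one. -/
lemma exists_failsAt {x : Fin 4 → ℤ} (hx : Nondegenerate x)
    (h : (fun i => (x i : ℤ_[p])) ∉ padicSoluble p) : ∃ k, FailsAt p k x := by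
  classical
  have hex : ∃ k, ¬ Lifts p k x := by
    let n := ∑ i, (x i).natAbs
    refine ⟨n + digits p + 2, fun hl => h (mem_padicSoluble_of_lifts hx hl (by omega) ?_)⟩
    intro i hd
    have h1 : (p : ℤ) ^ n ∣ x i := (pow_dvd_pow _ (by omega)).trans hd
    have h2 : p ^ n ∣ (x i).natAbs := by
      rw [← Int.natCast_dvd]; exact_mod_cast h1
    have h3 := Nat.le_of_dvd (Int.natAbs_pos.2 (hx.ne_zero i)) h2
    have h4 : (x i).natAbs ≤ n :=
      Finset.single_le_sum (f := fun i => (x i).natAbs) (fun _ _ => Nat.zero_le _)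
        (Finset.mem_univ i)
    exact absurd (Nat.lt_pow_self hp.out.one_lt) (not_lt.2 (h3.trans h4))
  refine ⟨Nat.find hex, ?_, Nat.find_spec hex⟩
  by_contra hcon
  have := Nat.find_min' hex hcon
  have h0 : Nat.find hex ≠ 0 := by
    intro h0
    have := Nat.find_spec hex
    rw [h0] at this
    exact this (lifts_zero x)
  omega

end

/-! ### Periodic sets, their densities and their counts in boxes -/

/-- The set `E` of integral vectors is a union of residue classes modulo `q`. -/
def Periodic (q : ℕ) (E : Set (Fin 4 → ℤ)) : Prop :=
  ∀ x x', (∀ i, (q : ℤ) ∣ x i - x' i) → x ∈ E → x' ∈ E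

/-- The image of `E` in the residue classes modulo `q`. -/
def residues (q : ℕ) (E : Set (Fin 4 → ℤ)) : Set (Fin 4 → ZMod q) :=
  (fun x i => (x i : ZMod q)) '' E

/-- The proportion of the residue classes modulo `q` that meet `E`. -/
noncomputable def density (q : ℕ) (E : Set (Fin 4 → ℤ)) : ℝ :=
  ((residues q E).ncard : ℝ) / (q : ℝ) ^ 4

lemma density_nonneg (q : ℕ) (E : Set (Fin 4 → ℤ)) : 0 ≤ density q E := by
  unfold density; positivity

lemma Periodic.mem_iff {q : ℕ} {E : Set (Fin 4 → ℤ)} (hE : Periodic q E) (x : Fin 4 → ℤ) :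
    (fun i => (x i : ZMod q)) ∈ residues q E ↔ x ∈ E := by
  refine ⟨?_, fun h => ⟨x, h, rfl⟩⟩
  rintro ⟨y, hy, hyx⟩
  refine hE y x (fun i => ?_) hy
  have := congrFun hyx i
  exact (ZMod.intCast_eq_intCast_iff_dvd_sub _ _ _).1 this.symm

lemma Periodic.of_dvd {q r : ℕ} {E : Set (Fin 4 → ℤ)} (hE : Periodic q E) (h : q ∣ r) :
    Periodic r E :=
  fun x x' hx hxE => hE x x' (fun i => (Int.natCast_dvd_natCast.2 h).trans (hx i)) hxE

lemma Periodic.diff {q : ℕ} {E F : Set (Fin 4 → ℤ)} (hE : Periodic q E) (hF : Periodic q F) :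
    Periodic q (E \ F) :=
  fun x x' hx hxE => ⟨hE x x' hx hxE.1, fun h => hxE.2 (hF x' x (fun i => by
    rw [← neg_sub]; exact (dvd_neg.2 (hx i))) h)⟩

open Classical in
lemma Periodic.card_filter_piFinset {q : ℕ} [NeZero q] {E : Set (Fin 4 → ℤ)} (hE : Periodic q E)
    (I : Fin 4 → Finset ℤ) :
    ((Fintype.piFinset I).filter (· ∈ E)).card =
      ∑ r ∈ (residues q E).toFinset, ∏ i, ((I i).filter fun n : ℤ => (n : ZMod q) = r i).card := by
  rw [Finset.card_eq_sum_card_fiberwise (t := (residues q E).toFinset)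
    (f := fun (x : Fin 4 → ℤ) i => (x i : ZMod q))]
  · refine Finset.sum_congr rfl fun r hr => ?_
    rw [← Fintype.card_piFinset]
    refine congrArg Finset.card (Finset.ext fun x => ?_)
    simp only [Finset.mem_filter, Fintype.mem_piFinset]
    constructor
    · rintro ⟨⟨h1, -⟩, h2⟩ i
      exact ⟨h1 i, congrFun h2 i⟩
    · intro h
      refine ⟨⟨fun i => (h i).1, ?_⟩, funext fun i => (h i).2⟩
      rw [← hE.mem_iff, funext fun i => (h i).2]
      exact Set.mem_toFinset.1 hr
  · intro x hx
    simp only [Finset.coe_filter, Set.mem_ofPred_eq] at hx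
    simpa using ⟨x, hx.2, rfl⟩

/-- The initial point of the interval of the `N` positive or negative integers closest to `0`. -/
def start (b : Bool) (N : ℕ) : ℤ := if b then 0 else -(N : ℤ) - 1

/-- The integral points of height at most `N` in the open orthant with signs given by `s`. -/
noncomputable def box (s : Fin 4 → Bool) (N : ℕ) : Finset (Fin 4 → ℤ) :=
  Fintype.piFinset fun i => Finset.Ioc (start (s i) N) (start (s i) N + N)

/-- The number of points of `E` in `box s N`. -/
noncomputable def count (s : Fin 4 → Bool) (N : ℕ) (E : Set (Fin 4 → ℤ)) : ℕ :=
  ((box s N : Set (Fin 4 → ℤ)) ∩ E).ncard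

open Classical in
lemma count_eq_card (s : Fin 4 → Bool) (N : ℕ) (E : Set (Fin 4 → ℤ)) :
    count s N E = ((box s N).filter (· ∈ E)).card := by
  rw [count, ← Set.ncard_coe_finset, Finset.coe_filter]
  rfl

/-- One unit of error comes from the two floors in the count of a residue class, the other from
replacing `N` by `P`. -/
lemma abs_card_residue_sub_le {q : ℕ} [NeZero q] (a : ℤ) (N : ℕ) (r : ZMod q) {P : ℝ}
    (hN : (N : ℝ) ≤ P) (hP : P < N + 1) :
    |(((Finset.Ioc a (a + N)).filter fun n : ℤ => (n : ZMod q) = r).card : ℝ) - P / q| ≤ 2 := by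
  obtain ⟨v, rfl⟩ := ZMod.intCast_surjective r
  have hq : (0 : ℤ) < q := by exact_mod_cast Nat.pos_of_ne_zero (NeZero.ne q)
  have hq' : (0 : ℝ) < q := by exact_mod_cast hq
  have hq1 : (1 : ℝ) ≤ q := by exact_mod_cast hq
  have h := Int.Ioc_filter_modEq_card a (a + N) hq v
  have hfilter : ((Finset.Ioc a (a + N)).filter fun n : ℤ => (n : ZMod q) = (v : ZMod q)) =
      (Finset.Ioc a (a + N)).filter fun n : ℤ => n ≡ v [ZMOD q] := by
    refine Finset.filter_congr fun n _ => ?_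
    exact ZMod.intCast_eq_intCast_iff _ _ _
  rw [hfilter]
  set A : ℚ := ((a : ℚ) - v) / ((q : ℤ) : ℚ) with hA
  set B : ℚ := (((a + N : ℤ) : ℚ) - v) / ((q : ℤ) : ℚ) with hB
  have hBA : B - A = N / q := by
    rw [hA, hB]; push_cast; ring
  have hmono : ⌊A⌋ ≤ ⌊B⌋ := by
    apply Int.floor_le_floor
    have : (0 : ℚ) ≤ N / q := by positivity
    linarith
  rw [max_eq_left (by linarith)] at h
  have hcard : ((((Finset.Ioc a (a + N)).filter fun n : ℤ => n ≡ v [ZMOD q]).card : ℕ) : ℚ) =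
      ⌊B⌋ - ⌊A⌋ := by exact_mod_cast h
  have hle : |((((Finset.Ioc a (a + N)).filter fun n : ℤ => n ≡ v [ZMOD q]).card : ℕ) : ℚ)
      - N / q| ≤ 1 := by
    rw [hcard, ← hBA, abs_le]
    have h1 := Int.floor_le A
    have h2 := Int.lt_floor_add_one A
    have h3 := Int.floor_le B
    have h4 := Int.lt_floor_add_one B
    constructor <;> linarith
  have hle' : |((((Finset.Ioc a (a + N)).filter fun n : ℤ => n ≡ v [ZMOD q]).card : ℕ) : ℝ)
      - N / q| ≤ 1 := by
    have := (Rat.cast_le (K := ℝ)).2 hle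
    push_cast at this
    exact this
  have h5 : |(N : ℝ) / q - P / q| ≤ 1 := by
    rw [← sub_div, abs_div, abs_of_pos hq', div_le_one hq', abs_le]
    constructor <;> linarith
  calc _ = |(((((Finset.Ioc a (a + N)).filter fun n : ℤ => n ≡ v [ZMOD q]).card : ℕ) : ℝ)
      - N / q) + (N / q - P / q)| := by ring_nf
    _ ≤ _ := abs_add_le _ _
    _ ≤ 2 := by linarith

lemma abs_prod_four_sub_le {f : Fin 4 → ℝ} {t : ℝ} (ht : 1 ≤ t) (hf : ∀ i, 0 ≤ f i)
    (h : ∀ i, |f i - t| ≤ 2) : |∏ i, f i - t ^ 4| ≤ 80 * t ^ 3 := by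
  have hle : ∀ i, f i ≤ 3 * t := fun i => by have := (abs_le.1 (h i)).2; linarith
  have ht0 : 0 ≤ t := by linarith
  have h1 : |(f 0 - t) * (f 1 * f 2 * f 3)| ≤ 2 * (27 * t ^ 3) := by
    rw [abs_mul, abs_of_nonneg (mul_nonneg (mul_nonneg (hf 1) (hf 2)) (hf 3))]
    refine mul_le_mul (h 0) ?_ (mul_nonneg (mul_nonneg (hf 1) (hf 2)) (hf 3)) (by norm_num)
    calc f 1 * f 2 * f 3 ≤ (3 * t) * (3 * t) * (3 * t) := by
          have := hf 1; have := hf 2; have := hf 3; have := hle 1; have := hle 2; have := hle 3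
          gcongr
      _ = _ := by ring
  have h2 : |(f 1 - t) * (t * f 2 * f 3)| ≤ 2 * (9 * t ^ 3) := by
    rw [abs_mul, abs_of_nonneg (mul_nonneg (mul_nonneg ht0 (hf 2)) (hf 3))]
    refine mul_le_mul (h 1) ?_ (mul_nonneg (mul_nonneg ht0 (hf 2)) (hf 3)) (by norm_num)
    calc t * f 2 * f 3 ≤ t * (3 * t) * (3 * t) := by
          have := hf 2; have := hf 3; have := hle 2; have := hle 3
          gcongr
      _ = _ := by ring
  have h3 : |(f 2 - t) * (t * t * f 3)| ≤ 2 * (3 * t ^ 3) := by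
    rw [abs_mul, abs_of_nonneg (mul_nonneg (mul_nonneg ht0 ht0) (hf 3))]
    refine mul_le_mul (h 2) ?_ (mul_nonneg (mul_nonneg ht0 ht0) (hf 3)) (by norm_num)
    calc t * t * f 3 ≤ t * t * (3 * t) := by
          have := hle 3
          gcongr
      _ = _ := by ring
  have h4 : |(f 3 - t) * (t * t * t)| ≤ 2 * t ^ 3 := by
    rw [abs_mul, abs_of_nonneg (by positivity : 0 ≤ t * t * t)]
    calc |f 3 - t| * (t * t * t) ≤ 2 * (t * t * t) := by gcongr; exact h 3
      _ = _ := by ring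
  -- Replacing the factors by `t` one at a time, with `f i ≤ 3 * t`, gives `54 + 18 + 6 + 2 = 80`.
  have e : ∏ i, f i - t ^ 4 = (f 0 - t) * (f 1 * f 2 * f 3) + (f 1 - t) * (t * f 2 * f 3) +
      (f 2 - t) * (t * t * f 3) + (f 3 - t) * (t * t * t) := by
    rw [Fin.prod_univ_four]; ring
  rw [e]
  refine (abs_add_le _ _).trans ((add_le_add_left ((abs_add_le _ _).trans
    (add_le_add_left (abs_add_le _ _) _)) _).trans ?_)
  linarith

/-- The number of points of a periodic set in a box. -/
lemma Periodic.abs_count_sub_le {q : ℕ} [NeZero q] {E : Set (Fin 4 → ℤ)} (hE : Periodic q E)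
    (s : Fin 4 → Bool) {N : ℕ} {P : ℝ} (hN : (N : ℝ) ≤ P) (hP : P < N + 1) (hq : (q : ℝ) ≤ P) :
    |(count s N E : ℝ) - density q E * P ^ 4| ≤
      80 * (density q E * q * P ^ 3) := by
  have hq' : (0 : ℝ) < q := by exact_mod_cast Nat.pos_of_ne_zero (NeZero.ne q)
  classical
  rw [count_eq_card, box, hE.card_filter_piFinset]
  have hden : density q E * P ^ 4 = ∑ r ∈ (residues q E).toFinset, (P / q) ^ 4 := by
    rw [Finset.sum_const, nsmul_eq_mul, density, Set.ncard_eq_toFinset_card']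
    ring
  rw [hden]
  push_cast
  rw [← Finset.sum_sub_distrib]
  refine (Finset.abs_sum_le_sum_abs _ _).trans ?_
  calc _ ≤ ∑ r ∈ (residues q E).toFinset, 80 * (P / q) ^ 3 := by
        refine Finset.sum_le_sum fun r _ => ?_
        exact abs_prod_four_sub_le ((one_le_div hq').2 hq) (fun i => Nat.cast_nonneg _)
          fun i => abs_card_residue_sub_le _ _ _ hN hP
    _ = _ := by
        rw [Finset.sum_const, nsmul_eq_mul, density, Set.ncard_eq_toFinset_card']
        field_simp

/-- The proportion of the points of a box that lie in a periodic set tends to the density. -/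
lemma Periodic.tendsto_count_div {q : ℕ} [NeZero q] {E : Set (Fin 4 → ℤ)} (hE : Periodic q E)
    (s : Fin 4 → Bool) :
    Tendsto (fun N : ℕ => (count s N E : ℝ) / (N : ℝ) ^ 4) atTop
      (𝓝 (density q E)) := by
  have h0 : Tendsto (fun N : ℕ => 80 * (density q E * q) / (N : ℝ)) atTop (𝓝 0) :=
    tendsto_const_div_atTop_nhds_zero_nat _
  rw [tendsto_iff_norm_sub_tendsto_zero]
  refine squeeze_zero' (Eventually.of_forall fun N => norm_nonneg _) ?_ h0
  filter_upwards [eventually_ge_atTop (max q 1)] with N hN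
  have hN1 : (0 : ℝ) < N := by exact_mod_cast (le_max_right _ _).trans hN
  have h := hE.abs_count_sub_le s (N := N) le_rfl (by linarith)
    (by exact_mod_cast (le_max_left _ _).trans hN)
  rw [Real.norm_eq_abs, show (count s N E : ℝ) / (N : ℝ) ^ 4 - density q E =
    ((count s N E : ℝ) - density q E * N ^ 4) / (N : ℝ) ^ 4 by
      field_simp, abs_div, abs_of_pos (pow_pos hN1 4), div_le_div_iff₀ (pow_pos hN1 4) hN1]
  calc _ ≤ 80 * (density q E * q * N ^ 3) * N := by gcongr
    _ = _ := by ring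

/-- Both densities are the limit of the same proportion in growing boxes, which does not mention the
modulus. -/
lemma Periodic.density_eq {q r : ℕ} [NeZero q] [NeZero r] {E : Set (Fin 4 → ℤ)}
    (hE : Periodic q E) (hE' : Periodic r E) : density q E = density r E :=
  tendsto_nhds_unique (hE.tendsto_count_div fun _ => true)
    (hE'.tendsto_count_div fun _ => true)

lemma Periodic.density_diff {q : ℕ} [NeZero q] {E F : Set (Fin 4 → ℤ)} (hE : Periodic q E)
    (hF : Periodic q F) (hFE : F ⊆ E) : density q (E \ F) = density q E - density q F := by
  refine tendsto_nhds_unique ((hE.diff hF).tendsto_count_div fun _ => true) ?_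
  refine ((hE.tendsto_count_div fun _ => true).sub
    (hF.tendsto_count_div fun _ => true)).congr fun N => ?_
  rw [← sub_div]
  congr 1
  rw [sub_eq_iff_eq_add]
  norm_cast
  rw [count, count, count, ← Set.ncard_sdiff_add_ncard_of_subset
    (Set.inter_subset_inter_right (box (fun _ => true) N : Set (Fin 4 → ℤ)) hFE)
    ((box (fun _ => true) N).finite_toSet.subset Set.inter_subset_left),
    Set.inter_sdiff_distrib_left]

/-- Densities for coprime moduli multiply. -/
lemma density_inter {m n : ℕ} [NeZero m] [NeZero n] (hmn : m.Coprime n) {E F : Set (Fin 4 → ℤ)}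
    (hE : Periodic m E) (hF : Periodic n F) :
    density (m * n) (E ∩ F) = density m E * density n F := by
  let e := ZMod.chineseRemainder hmn
  let φ : (Fin 4 → ZMod (m * n)) → (Fin 4 → ZMod m) × (Fin 4 → ZMod n) :=
    fun r => (fun i => (e (r i)).1, fun i => (e (r i)).2)
  have hφ : Function.Injective φ := by
    intro r r' h
    funext i
    apply e.injective
    exact Prod.ext (congrFun (congrArg Prod.fst h) i) (congrFun (congrArg Prod.snd h) i)
  have hφx : ∀ x : Fin 4 → ℤ, φ (fun i => (x i : ZMod (m * n))) =
      (fun i => (x i : ZMod m), fun i => (x i : ZMod n)) := by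
    intro x
    simp [φ]
  have himg : φ '' residues (m * n) (E ∩ F) = residues m E ×ˢ residues n F := by
    ext ⟨r, t⟩
    constructor
    · rintro ⟨_, ⟨x, hx, rfl⟩, h⟩
      rw [hφx] at h
      rw [← h]
      exact ⟨⟨x, hx.1, rfl⟩, ⟨x, hx.2, rfl⟩⟩
    · rintro ⟨hr, ht⟩
      choose x hx using fun i => ZMod.intCast_surjective (e.symm (r i, t i))
      have h2 : φ (fun i => (x i : ZMod (m * n))) = (r, t) := by
        simp only [hx, φ, RingEquiv.apply_symm_apply]
      have h3 := (hφx x).symm.trans h2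
      refine ⟨_, ⟨x, ⟨?_, ?_⟩, rfl⟩, h2⟩
      · have h4 : (fun i => (x i : ZMod m)) = r := congrArg Prod.fst h3
        rw [← hE.mem_iff, h4]; exact hr
      · have h4 : (fun i => (x i : ZMod n)) = t := congrArg Prod.snd h3
        rw [← hF.mem_iff, h4]; exact ht
  have hcard := Set.ncard_image_of_injective (residues (m * n) (E ∩ F)) hφ
  rw [himg, Set.ncard_prod] at hcard
  rw [density, density, density, ← hcard]
  push_cast
  have hm : (m : ℝ) ≠ 0 := by exact_mod_cast NeZero.ne m
  have hn : (n : ℝ) ≠ 0 := by exact_mod_cast NeZero.ne n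
  field_simp

/-! ### Failure sets and the local densities -/

/-- The integral vectors that fail at each prime `p ∣ q`, for the first time modulo the exact power
of `p` dividing `q`. -/
def failSet (q : ℕ) : Set (Fin 4 → ℤ) :=
  {x | ∀ p ∈ q.primeFactors, FailsAt p (q.factorization p) x}

lemma periodic_lifts (p k : ℕ) : Periodic (p ^ k) {x | Lifts p k x} :=
  fun x x' hx h => Lifts.congr (p := p) (k := k) h fun i => by exact_mod_cast hx i

lemma periodic_failsAt (p k : ℕ) : Periodic (p ^ k) {x | FailsAt p k x} :=
  ((periodic_lifts p (k - 1)).of_dvd (pow_dvd_pow p (Nat.sub_le k 1))).diff (periodic_lifts p k)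

lemma periodic_failSet (q : ℕ) : Periodic q (failSet q) := by
  intro x x' hx h p hp
  refine periodic_failsAt p (q.factorization p) x x' (fun i => ?_) (h p hp)
  exact (Int.natCast_dvd_natCast.2 (Nat.ordProj_dvd q p)).trans (hx i)

lemma failSet_mul {m n : ℕ} (h : m.Coprime n) :
    failSet (m * n) = failSet m ∩ failSet n := by
  ext x
  simp only [failSet, Set.mem_ofPred_eq, Set.mem_inter_iff, h.primeFactors_mul, Finset.mem_union]
  have hm : ∀ p ∈ m.primeFactors, (m * n).factorization p = m.factorization p := fun p hp =>
    Nat.factorization_eq_of_coprime_left h (by simpa using hp)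
  have hn : ∀ p ∈ n.primeFactors, (m * n).factorization p = n.factorization p := fun p hp =>
    Nat.factorization_eq_of_coprime_right h (by simpa using hp)
  constructor
  · exact fun H => ⟨fun p hp => hm p hp ▸ H p (Or.inl hp), fun p hp => hn p hp ▸ H p (Or.inr hp)⟩
  · rintro ⟨h1, h2⟩ p (hp | hp)
    · exact (hm p hp).symm ▸ h1 p hp
    · exact (hn p hp).symm ▸ h2 p hp

lemma failSet_prime_pow {p k : ℕ} (hp : p.Prime) (hk : k ≠ 0) :
    failSet (p ^ k) = {x | FailsAt p k x} := by
  ext x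
  simp [failSet, Nat.primeFactors_prime_pow hk hp, hp.factorization_pow]

lemma density_mul_failSet {m n : ℕ} (h : m.Coprime n) (hm : m ≠ 0) (hn : n ≠ 0) :
    density (m * n) (failSet (m * n)) = density m (failSet m) * density n (failSet n) := by
  have : NeZero m := ⟨hm⟩
  have : NeZero n := ⟨hn⟩
  rw [failSet_mul h, density_inter h (periodic_failSet m) (periodic_failSet n)]

lemma density_one_univ : density 1 Set.univ = 1 := by
  have h : residues 1 Set.univ = Set.univ := by
    ext r
    simp only [residues, Set.image_univ, Set.mem_range, Set.mem_univ, iff_true]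
    exact ⟨0, Subsingleton.elim _ _⟩
  simp [density, h, Set.ncard_univ]

lemma failSet_one : failSet 1 = Set.univ := by
  ext x; simp [failSet]

section

variable {p : ℕ} [hp : Fact p.Prime]

lemma padicProportion_eq_density (k : ℕ) :
    padicProportion p k = density (p ^ k) {x | Lifts p k x} := by
  have h : ((fun (x : Fin 4 → ℤ_[p]) (i : Fin 4) => PadicInt.toZModPow k (x i)) ''
      padicSoluble p) = residues (p ^ k) {x | Lifts p k x} := by
    have aux : ∀ (a : ℤ_[p]) (b : ℤ), (p : ℤ_[p]) ^ k ∣ a - b ↔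
        PadicInt.toZModPow k a = (b : ZMod (p ^ k)) := by
      intro a b
      rw [← Ideal.mem_span_singleton, ← PadicInt.ker_toZModPow, RingHom.mem_ker, map_sub,
        sub_eq_zero, map_intCast]
    ext r
    constructor
    · rintro ⟨y, hy, rfl⟩
      choose x hx using fun i => ZMod.intCast_surjective (PadicInt.toZModPow k (y i))
      exact ⟨x, ⟨hp, y, hy, fun i => (aux _ _).2 (hx i).symm⟩, funext hx⟩
    · rintro ⟨x, ⟨_, y, hy, hd⟩, rfl⟩
      exact ⟨y, hy, funext fun i => (aux _ _).1 (hd i)⟩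
  rw [padicProportion, h, density]
  push_cast
  rw [← pow_mul, mul_comm k 4]

/-- The vectors first failing modulo `p ^ (k + 1)` are those that lift modulo `p ^ k` minus those
that lift modulo `p ^ (k + 1)`. This is the telescoping behind the Euler factor. -/
lemma density_failSet_prime_pow (k : ℕ) :
    density (p ^ (k + 1)) (failSet (p ^ (k + 1))) =
      padicProportion p k - padicProportion p (k + 1) := by
  have : NeZero p := ⟨hp.out.ne_zero⟩
  have h1 : Periodic (p ^ (k + 1)) {x | Lifts p k x} :=
    (periodic_lifts p k).of_dvd (pow_dvd_pow p (Nat.le_succ k))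
  rw [failSet_prime_pow hp.out (Nat.succ_ne_zero k), padicProportion_eq_density,
    padicProportion_eq_density, (periodic_lifts p k).density_eq h1]
  exact h1.density_diff (periodic_lifts p (k + 1)) fun x hx =>
    Lifts.mono (p := p) hx (Nat.le_succ k)

lemma padicProportion_zero : padicProportion p 0 = 1 := by
  rw [padicProportion_eq_density, pow_zero, ← density_one_univ]
  congr 1
  ext x
  simp [lifts_zero x]

lemma antitone_padicProportion : Antitone (padicProportion p) := by
  refine antitone_nat_of_succ_le fun k => ?_
  have := density_nonneg (p ^ (k + 1)) (failSet (p ^ (k + 1)))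
  rw [density_failSet_prime_pow] at this
  linarith

/-- The proportions decrease and are bounded below by `0`, so the limit defining `tauPrime` exists.
-/
lemma tendsto_padicProportion : Tendsto (padicProportion p) atTop (𝓝 (tauPrime p)) := by
  refine tendsto_nhds_limUnder ⟨_, tendsto_atTop_ciInf antitone_padicProportion ⟨0, ?_⟩⟩
  rintro _ ⟨k, rfl⟩
  unfold padicProportion
  positivity

lemma hasSum_density_failSet :
    HasSum (fun k : ℕ => density (p ^ (k + 1)) (failSet (p ^ (k + 1)))) (1 - tauPrime p) := by
  rw [hasSum_iff_tendsto_nat_of_nonneg fun k => density_nonneg _ _]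
  have : ∀ n, ∑ k ∈ Finset.range n, density (p ^ (k + 1)) (failSet (p ^ (k + 1))) =
      1 - padicProportion p n := by
    intro n
    rw [← padicProportion_zero (p := p), ← Finset.sum_range_sub']
    exact Finset.sum_congr rfl fun k _ => density_failSet_prime_pow k
  simp only [this]
  exact tendsto_padicProportion.const_sub 1

end

/-! ### Divisibility forced by failure and the uniform bound in boxes -/

/-- Bound for the density of the vectors that fail at `p` for the first time modulo `p ^ k`. -/
noncomputable def localWeight (p k : ℕ) : ℝ := 384 / (p : ℝ) ^ max k 2

/-- The multiplicative function with values `localWeight p k` at prime powers. -/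
noncomputable def weight (q : ℕ) : ℝ := q.factorization.prod localWeight

/-- The vector of divisors of the coefficients forced by a failure at `p` modulo `p ^ k`, with the
position of the large divisors given by `c`. -/
def divisors (p k : ℕ) (c : Fin 4 × Fin 4) (l : Fin 4) : ℕ :=
  if p = 2 then if l = c.1 then 2 ^ (k - 5) else 1
  else if l = c.1 then p ^ max (k - 1) 1 else if l = c.2 then p else 1

lemma exists_divisors_eq_pow (p k : ℕ) (c : Fin 4 × Fin 4) (l : Fin 4) :
    ∃ e, divisors p k c l = p ^ e := by
  unfold divisors
  split_ifs with h1 h2 h3 h4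
  · exact ⟨k - 5, by rw [h1]⟩
  · exact ⟨0, by simp⟩
  · exact ⟨_, rfl⟩
  · exact ⟨1, by simp⟩
  · exact ⟨0, by simp⟩

lemma FailsAt.exists_divisors_dvd {p k : ℕ} [Fact p.Prime] {x : Fin 4 → ℤ} (h : FailsAt p k x)
    (hx : Nondegenerate x) :
    ∃ c ∈ (Finset.univ : Finset (Fin 4)).offDiag, ∀ l, (divisors p k c l : ℤ) ∣ x l := by
  by_cases hp : p = 2
  · subst hp
    obtain ⟨i, hi⟩ := h.exists_dvd_two hx
    refine ⟨(i, i + 1), by simp, fun l => ?_⟩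
    unfold divisors
    rw [if_pos rfl]
    split_ifs with hl
    · rw [hl]; exact_mod_cast hi
    · simp
  · obtain ⟨i, j, hij, hi, hj⟩ := h.exists_dvd_of_odd hx hp
    refine ⟨(i, j), by simpa using hij, fun l => ?_⟩
    unfold divisors
    rw [if_neg hp]
    split_ifs with hl hl'
    · rw [hl]; exact_mod_cast hi
    · rw [hl']; exact hj
    · simp

/-- The constant `384` is `12 * 32`: there are twelve ordered pairs of distinct positions, and `32 =
2 ^ 5` covers the five lost digits at `p = 2`. -/
lemma sum_prod_inv_divisors_le {p k : ℕ} (hp : p.Prime) :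
    ∑ c ∈ (Finset.univ : Finset (Fin 4)).offDiag, ∏ l, ((divisors p k c l : ℝ))⁻¹ ≤
      localWeight p k := by
  have hp0 : (0 : ℝ) < p := by exact_mod_cast hp.pos
  have hcard : (Finset.univ : Finset (Fin 4)).offDiag.card = 12 := by decide
  have h : ∀ c ∈ (Finset.univ : Finset (Fin 4)).offDiag,
      ∏ l, ((divisors p k c l : ℝ))⁻¹ ≤ 32 / (p : ℝ) ^ max k 2 := by
    rintro ⟨i, j⟩ hc
    have hij : i ≠ j := by simpa using hc
    unfold divisors
    by_cases h2 : p = 2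
    · subst h2
      simp only [if_true]
      have : ∏ l : Fin 4, (((if l = i then 2 ^ (k - 5) else 1 : ℕ) : ℝ))⁻¹ = (2 ^ (k - 5))⁻¹ := by
        push_cast
        simp [apply_ite]
      rw [this, inv_eq_one_div, div_le_div_iff₀ (by positivity) (by positivity), one_mul,
        show (32 : ℝ) = 2 ^ 5 by norm_num, ← pow_add]
      push_cast
      exact pow_le_pow_right₀ (by norm_num) (by omega)
    · simp only [if_neg h2]
      have : ∏ l : Fin 4, (((if l = i then p ^ max (k - 1) 1 else if l = j then p else 1 : ℕ) :
          ℝ))⁻¹ = (p ^ max (k - 1) 1 * p : ℝ)⁻¹ := by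
        rw [Finset.prod_inv_distrib]
        congr 1
        rw [← Finset.mul_prod_erase _ _ (Finset.mem_univ i),
          ← Finset.mul_prod_erase _ _ (Finset.mem_erase.2 ⟨hij.symm, Finset.mem_univ j⟩)]
        rw [Finset.prod_eq_one]
        · simp [hij.symm]
        · intro l hl
          simp only [Finset.mem_erase] at hl
          simp [hl.1, hl.2.1]
      rw [this, ← pow_succ, show max (k - 1) 1 + 1 = max k 2 by omega, div_eq_mul_inv]
      have : (0 : ℝ) ≤ ((p : ℝ) ^ max k 2)⁻¹ := by positivity
      linarith
  calc _ ≤ ∑ c ∈ (Finset.univ : Finset (Fin 4)).offDiag, 32 / (p : ℝ) ^ max k 2 :=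
        Finset.sum_le_sum h
    _ = localWeight p k := by
        rw [Finset.sum_const, hcard, localWeight, nsmul_eq_mul]
        push_cast
        ring

lemma mem_box_iff {s : Fin 4 → Bool} {N : ℕ} {x : Fin 4 → ℤ} :
    x ∈ box s N ↔ ∀ i, (x i).natAbs ≤ N ∧ x i ≠ 0 ∧ (0 < x i ↔ s i = true) := by
  simp only [box, Fintype.mem_piFinset, Finset.mem_Ioc, start]
  refine forall_congr' fun i => ?_
  rcases hs : s i
  · simp; omega
  · simp; omega

/-- The intervals avoid `0`, so there are `⌊N / d⌋` multiples and no additive error. This keeps the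
bounds uniform in `q`, however large. -/
lemma card_filter_dvd_le (b : Bool) (N d : ℕ) :
    (((Finset.Ioc (start b N) (start b N + N)).filter fun n : ℤ => (d : ℤ) ∣ n).card : ℝ) ≤
      N * (d : ℝ)⁻¹ := by
  have h : ((Finset.Ioc (start b N) (start b N + N)).filter fun n : ℤ => (d : ℤ) ∣ n).card ≤
      ((Finset.Ioc 0 N).filter fun n => d ∣ n).card := by
    refine Finset.card_le_card_of_injOn Int.natAbs ?_ ?_
    · intro n hn
      simp only [Finset.coe_filter, Finset.mem_Ioc, Set.mem_ofPred_eq] at hn ⊢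
      refine ⟨?_, Int.natCast_dvd.1 hn.2⟩
      cases b <;> simp [start] at hn <;> omega
    · intro n hn m hm hnm
      simp only [Finset.coe_filter, Finset.mem_Ioc, Set.mem_ofPred_eq] at hn hm
      cases b <;> simp [start] at hn hm <;> omega
  rw [Nat.Ioc_filter_dvd_card_eq_div] at h
  calc _ ≤ ((N / d : ℕ) : ℝ) := by exact_mod_cast h
    _ ≤ N / d := Nat.cast_div_le
    _ = _ := div_eq_mul_inv _ _

/-- The number of nondegenerate points of `failSet q` in a box. -/
lemma count_failSet_le (s : Fin 4 → Bool) (N : ℕ) (q : ℕ) :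
    (count s N (failSet q ∩ {x | Nondegenerate x}) : ℝ) ≤ weight q * (N : ℝ) ^ 4 := by
  classical
  let S := q.primeFactors
  let k := fun p => q.factorization p
  let O := (Finset.univ : Finset (Fin 4)).offDiag
  have hS : ∀ p ∈ S, p.Prime := fun p hp => Nat.prime_of_mem_primeFactors hp
  let good : (∀ p ∈ S, Fin 4 × Fin 4) → Finset (Fin 4 → ℤ) := fun φ =>
    (box s N).filter fun x => ∀ p (hp : p ∈ S) l, (divisors p (k p) (φ p hp) l : ℤ) ∣ x l
  -- A failing vector selects, for each prime of `q`, the positions of its forced divisors; the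
  -- union bound runs over all such choices `φ`.
  have hsub : (box s N).filter (· ∈ failSet q ∩ {x | Nondegenerate x}) ⊆
      (S.pi fun _ => O).biUnion good := by
    intro x hx
    rw [Finset.mem_filter] at hx
    have hex : ∀ p (hp : p ∈ S), ∃ c ∈ O, ∀ l, (divisors p (k p) c l : ℤ) ∣ x l := by
      intro p hp
      have : Fact p.Prime := ⟨hS p hp⟩
      exact (hx.2.1 p hp).exists_divisors_dvd hx.2.2
    choose φ hφ hφ' using hex
    rw [Finset.mem_biUnion]
    exact ⟨φ, Finset.mem_pi.2 hφ, Finset.mem_filter.2 ⟨hx.1, hφ'⟩⟩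
  have hgood : ∀ φ : ∀ p ∈ S, Fin 4 × Fin 4, ((good φ).card : ℝ) ≤
      (N : ℝ) ^ 4 * ∏ p ∈ S.attach, ∏ l, ((divisors p.1 (k p.1) (φ p.1 p.2) l : ℝ))⁻¹ := by
    intro φ
    have h1 : good φ ⊆ Fintype.piFinset fun l =>
        (Finset.Ioc (start (s l) N) (start (s l) N + N)).filter fun n : ℤ =>
          ((∏ p ∈ S.attach, divisors p.1 (k p.1) (φ p.1 p.2) l : ℕ) : ℤ) ∣ n := by
      intro x hx
      rw [Finset.mem_filter, box, Fintype.mem_piFinset] at hx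
      rw [Fintype.mem_piFinset]
      intro l
      rw [Finset.mem_filter]
      refine ⟨hx.1 l, ?_⟩
      push_cast
      refine Finset.prod_dvd_of_coprime ?_ fun p _ => hx.2 p.1 p.2 l
      intro p _ p' _ hpp'
      obtain ⟨e, he⟩ := exists_divisors_eq_pow p.1 (k p.1) (φ p.1 p.2) l
      obtain ⟨e', he'⟩ := exists_divisors_eq_pow p'.1 (k p'.1) (φ p'.1 p'.2) l
      simp only [Function.onFun, he, he', Nat.isCoprime_iff_coprime]
      exact Nat.Coprime.pow _ _ ((Nat.coprime_primes (hS _ p.2) (hS _ p'.2)).2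
        fun h => hpp' (Subtype.ext h))
    have h2 : ((good φ).card : ℝ) ≤ _ := Nat.cast_le.2 (Finset.card_le_card h1)
    refine h2.trans ?_
    rw [Fintype.card_piFinset]
    push_cast
    calc _ ≤ ∏ l : Fin 4, ((N : ℝ) *
          (((∏ p ∈ S.attach, divisors p.1 (k p.1) (φ p.1 p.2) l : ℕ) : ℝ))⁻¹) := by
          refine Finset.prod_le_prod (fun _ _ => Nat.cast_nonneg _) fun l _ => ?_
          refine le_trans (le_of_eq ?_) (card_filter_dvd_le (s l) N _)
          push_cast; rfl
      _ = _ := by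
          rw [Finset.prod_mul_distrib, Finset.prod_const, Finset.card_univ, Fintype.card_fin,
            Finset.prod_comm]
          congr 1
          refine Finset.prod_congr rfl fun l _ => ?_
          push_cast
          rw [Finset.prod_inv_distrib]
  calc (count s N (failSet q ∩ {x | Nondegenerate x}) : ℝ)
      ≤ ((∑ φ ∈ S.pi fun _ => O, (good φ).card : ℕ) : ℝ) := by
        rw [count_eq_card]
        refine Nat.cast_le.2 (le_trans (le_of_eq ?_)
          ((Finset.card_le_card hsub).trans Finset.card_biUnion_le))
        congr!
    _ ≤ ∑ φ ∈ S.pi fun _ => O, (N : ℝ) ^ 4 *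
          ∏ p ∈ S.attach, ∏ l, ((divisors p.1 (k p.1) (φ p.1 p.2) l : ℝ))⁻¹ := by
        push_cast
        exact Finset.sum_le_sum fun φ _ => hgood φ
    _ = (∏ p ∈ S, ∑ c ∈ O, ∏ l, ((divisors p (k p) c l : ℝ))⁻¹) * (N : ℝ) ^ 4 := by
        -- Distributivity turns the sum over all choices of positions into a product over primes.
        rw [Finset.prod_sum, ← Finset.mul_sum, mul_comm]
    _ ≤ weight q * (N : ℝ) ^ 4 := by
        gcongr
        rw [weight, Finsupp.prod, Nat.support_factorization]
        refine Finset.prod_le_prod (fun p _ => Finset.sum_nonneg fun c _ =>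
          Finset.prod_nonneg fun l _ => by positivity) fun p hp => ?_
        exact sum_prod_inv_divisors_le (hS p hp)

/-! ### Convergence of the sum of weights -/

/-- A nonnegative multiplicative function is summable if its values at the powers of primes are. -/
lemma summable_of_multiplicative {f b : ℕ → ℝ} (hf : ∀ n, 0 ≤ f n) (hf0 : f 0 = 0) (hf1 : f 1 = 1)
    (hmul : ∀ {m n : ℕ}, m.Coprime n → f (m * n) = f m * f n) (hb : ∀ n, 0 ≤ b n)
    (hbs : Summable b)
    (hp : ∀ {p : ℕ}, p.Prime → ∃ a ≤ b p, HasSum (fun k : ℕ => f (p ^ (k + 1))) a) :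
    Summable f := by
  have hsum : ∀ {p : ℕ}, p.Prime → ∃ a ≤ b p, HasSum (fun k : ℕ => f (p ^ k)) (1 + a) := by
    intro p hpp
    obtain ⟨a, ha, h⟩ := hp hpp
    refine ⟨a, ha, ?_⟩
    have := (hasSum_nat_add_iff (f := fun k : ℕ => f (p ^ k)) 1).1 h
    simpa [hf1, add_comm] using this
  refine summable_of_sum_range_le (c := Real.exp (∑' n, b n)) hf fun N => ?_
  -- The partial sum below `N` is dominated by the sum over `N`-smooth numbers, a finite Euler
  -- product, and `1 + a ≤ exp a` bounds it independently of `N`.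
  have hE := (EulerProduct.summable_and_hasSum_smoothNumbers_prod_primesBelow_tsum hf1 hmul
    (fun {p} hpp => by
      obtain ⟨a, -, h⟩ := hsum hpp
      simpa only [Real.norm_of_nonneg (hf _)] using h.summable) N).2
  have hE' := (hasSum_subtype_iff_indicator (f := f)).1 hE
  calc ∑ i ∈ Finset.range N, f i
      ≤ ∑ i ∈ Finset.range N, (N.smoothNumbers).indicator f i := by
        refine Finset.sum_le_sum fun i hi => ?_
        rcases Nat.eq_zero_or_pos i with rfl | hi0
        · rw [hf0]; exact Set.indicator_nonneg (fun _ _ => hf _) _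
        · rw [Set.indicator_of_mem (Nat.mem_smoothNumbers_of_lt hi0 (Finset.mem_range.1 hi))]
    _ ≤ ∏ p ∈ N.primesBelow, ∑' n : ℕ, f (p ^ n) :=
        sum_le_hasSum _ (fun _ _ => Set.indicator_nonneg (fun _ _ => hf _) _) hE'
    _ ≤ ∏ p ∈ N.primesBelow, Real.exp (b p) := by
        refine Finset.prod_le_prod (fun p _ => tsum_nonneg fun _ => hf _) fun p hpN => ?_
        obtain ⟨a, ha, h⟩ := hsum (Nat.prime_of_mem_primesBelow hpN)
        rw [h.tsum_eq]
        calc 1 + a ≤ b p + 1 := by linarith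
          _ ≤ _ := Real.add_one_le_exp _
    _ = Real.exp (∑ p ∈ N.primesBelow, b p) := (Real.exp_sum _ _).symm
    _ ≤ _ := Real.exp_le_exp.2 (hbs.sum_le_tsum _ fun _ _ => hb _)

/-- For exponent `1` the power of `p` is `-7/4`; for exponent `j + 2` it is `-3/2 - 3j/4`. The
constant doubles from `384` to `768` because `2 ^ (-3/4) ≥ 1/2` is used to shift the geometric
factor from `j` to `j + 1`. -/
lemma localWeight_mul_rpow_le {p : ℕ} (hp : p.Prime) (k : ℕ) :
    localWeight p (k + 1) * ((p ^ (k + 1) : ℕ) : ℝ) ^ (1 / 4 : ℝ) ≤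
      768 * (p : ℝ) ^ (-(3 / 2) : ℝ) * ((2 : ℝ) ^ (-(3 / 4) : ℝ)) ^ k := by
  have hp0 : (0 : ℝ) < p := by exact_mod_cast hp.pos
  have hp2 : (2 : ℝ) ≤ p := by exact_mod_cast hp.two_le
  have hlhs : localWeight p (k + 1) * ((p ^ (k + 1) : ℕ) : ℝ) ^ (1 / 4 : ℝ) =
      384 * (p : ℝ) ^ (((k + 1 : ℕ) : ℝ) * (1 / 4) - ((max (k + 1) 2 : ℕ) : ℝ)) := by
    rw [localWeight, Real.rpow_sub hp0, Real.rpow_natCast, Real.rpow_mul hp0.le,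
      Real.rpow_natCast]
    push_cast
    ring
  rw [hlhs]
  rcases k with _ | j
  · simp only [zero_add, pow_zero, mul_one]
    have : (p : ℝ) ^ (((1 : ℕ) : ℝ) * (1 / 4) - ((max 1 2 : ℕ) : ℝ)) ≤
        (p : ℝ) ^ (-(3 / 2) : ℝ) :=
      Real.rpow_le_rpow_of_exponent_le (by linarith) (by norm_num)
    have h0 : 0 ≤ (p : ℝ) ^ (-(3 / 2) : ℝ) := by positivity
    linarith
  · have h1 : (p : ℝ) ^ (((j + 1 + 1 : ℕ) : ℝ) * (1 / 4) - ((max (j + 1 + 1) 2 : ℕ) : ℝ)) =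
        (p : ℝ) ^ (-(3 / 2) : ℝ) * ((p : ℝ) ^ (-(3 / 4) : ℝ)) ^ j := by
      rw [max_eq_left (by omega), ← Real.rpow_natCast, ← Real.rpow_mul hp0.le,
        ← Real.rpow_add hp0]
      congr 1
      push_cast
      ring
    rw [h1]
    have h2 : (p : ℝ) ^ (-(3 / 4) : ℝ) ≤ (2 : ℝ) ^ (-(3 / 4) : ℝ) :=
      Real.rpow_le_rpow_of_nonpos (by norm_num) hp2 (by norm_num)
    have h3 : (1 / 2 : ℝ) ≤ (2 : ℝ) ^ (-(3 / 4) : ℝ) := by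
      calc (1 / 2 : ℝ) = (2 : ℝ) ^ (-1 : ℝ) := by rw [Real.rpow_neg_one]; norm_num
        _ ≤ _ := Real.rpow_le_rpow_of_exponent_le (by norm_num) (by norm_num)
    calc 384 * ((p : ℝ) ^ (-(3 / 2) : ℝ) * ((p : ℝ) ^ (-(3 / 4) : ℝ)) ^ j)
        ≤ 384 * ((p : ℝ) ^ (-(3 / 2) : ℝ) * ((2 : ℝ) ^ (-(3 / 4) : ℝ)) ^ j) := by gcongr
      _ = 768 * (p : ℝ) ^ (-(3 / 2) : ℝ) * (((2 : ℝ) ^ (-(3 / 4) : ℝ)) ^ j * (1 / 2)) := by ring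
      _ ≤ 768 * (p : ℝ) ^ (-(3 / 2) : ℝ) *
          (((2 : ℝ) ^ (-(3 / 4) : ℝ)) ^ j * (2 : ℝ) ^ (-(3 / 4) : ℝ)) := by gcongr
      _ = _ := by rw [pow_succ]

lemma localWeight_nonneg (p k : ℕ) : 0 ≤ localWeight p k := by unfold localWeight; positivity

lemma weight_nonneg (q : ℕ) : 0 ≤ weight q := by
  rw [weight, Finsupp.prod]
  exact Finset.prod_nonneg fun _ _ => localWeight_nonneg _ _

lemma weight_one : weight 1 = 1 := by simp [weight]

lemma weight_mul {m n : ℕ} (h : m.Coprime n) : weight (m * n) = weight m * weight n := by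
  rw [weight, Nat.factorization_mul_of_coprime h, Finsupp.prod_add_index_of_disjoint]
  · rfl
  · exact h.disjoint_primeFactors

lemma weight_prime_pow {p k : ℕ} (hp : p.Prime) (hk : k ≠ 0) :
    weight (p ^ k) = localWeight p k := by
  rw [weight, Finsupp.prod, Nat.support_factorization, Nat.primeFactors_prime_pow hk hp,
    Finset.prod_singleton, hp.factorization_pow]
  simp

/-- The majorant `weight q * q ^ (1 / 4)`, extended by `0` to `q = 0`. -/
noncomputable def majorant (q : ℕ) : ℝ := if q = 0 then 0 else weight q * (q : ℝ) ^ (1 / 4 : ℝ)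

lemma majorant_nonneg (q : ℕ) : 0 ≤ majorant q := by
  unfold majorant
  have := weight_nonneg q
  split_ifs <;> positivity

lemma summable_majorant : Summable majorant := by
  have hr0 : (0 : ℝ) ≤ (2 : ℝ) ^ (-(3 / 4) : ℝ) := by positivity
  have hr1 : (2 : ℝ) ^ (-(3 / 4) : ℝ) < 1 :=
    Real.rpow_lt_one_of_one_lt_of_neg (by norm_num) (by norm_num)
  refine summable_of_multiplicative
    (b := fun p => 768 * (p : ℝ) ^ (-(3 / 2) : ℝ) * (1 - (2 : ℝ) ^ (-(3 / 4) : ℝ))⁻¹)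
    majorant_nonneg (if_pos rfl) (by simp [majorant, weight_one]) ?_ ?_ ?_ ?_
  · intro m n h
    rcases eq_or_ne m 0 with rfl | hm
    · simp [majorant]
    rcases eq_or_ne n 0 with rfl | hn
    · simp [majorant]
    rw [majorant, majorant, majorant, if_neg (mul_ne_zero hm hn), if_neg hm, if_neg hn,
      weight_mul h]
    push_cast
    rw [Real.mul_rpow (by positivity) (by positivity)]
    ring
  · intro n
    have : 0 < 1 - (2 : ℝ) ^ (-(3 / 4) : ℝ) := by linarith
    positivity
  · exact ((Real.summable_nat_rpow.2 (by norm_num)).mul_left _).mul_right _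
  · intro p hp
    have hle : ∀ k : ℕ, majorant (p ^ (k + 1)) ≤
        768 * (p : ℝ) ^ (-(3 / 2) : ℝ) * ((2 : ℝ) ^ (-(3 / 4) : ℝ)) ^ k := by
      intro k
      rw [majorant, if_neg (pow_ne_zero _ hp.ne_zero), weight_prime_pow hp (Nat.succ_ne_zero k)]
      exact localWeight_mul_rpow_le hp k
    have hg := (hasSum_geometric_of_lt_one hr0 hr1).mul_left (768 * (p : ℝ) ^ (-(3 / 2) : ℝ))
    have hs : Summable fun k : ℕ => majorant (p ^ (k + 1)) :=
      hg.summable.of_nonneg_of_le (fun _ => majorant_nonneg _) hle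
    exact ⟨_, hasSum_le hle hs.hasSum hg, hs.hasSum⟩

/-! ### Counts of failure sets, uniformly in the modulus -/

lemma count_mono (s : Fin 4 → Bool) (N : ℕ) {E F : Set (Fin 4 → ℤ)} (h : E ⊆ F) :
    count s N E ≤ count s N F :=
  Set.ncard_le_ncard (Set.inter_subset_inter_right _ h)
    ((box s N).finite_toSet.subset Set.inter_subset_left)

/-- Box coordinates are nonzero, so degeneracy means `ad = bc`, and `d` is determined by `a`, `b`,
`c`. -/
lemma count_degenerate_le (s : Fin 4 → Bool) (N : ℕ) :
    count s N {x | ¬ Nondegenerate x} ≤ N ^ 3 := by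
  classical
  let I := fun i => Finset.Ioc (start (s i) N) (start (s i) N + N)
  have hI : ∀ i, (I i).card = N := fun i => by simp [I]
  have h : count s N {x | ¬ Nondegenerate x} ≤ ((I 0) ×ˢ (I 1) ×ˢ (I 2)).card := by
    rw [count_eq_card]
    refine Finset.card_le_card_of_injOn (fun x => (x 0, x 1, x 2)) ?_ ?_
    · intro x hx
      simp only [Finset.coe_filter, Set.mem_ofPred_eq, box, Fintype.mem_piFinset] at hx
      simp only [Finset.coe_product, Set.mem_prod, Finset.mem_coe]
      exact ⟨hx.1 0, hx.1 1, hx.1 2⟩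
    · intro x hx y hy hxy
      simp only [Finset.coe_filter, Set.mem_ofPred_eq, mem_box_iff] at hx hy
      have key : ∀ z : Fin 4 → ℤ, (∀ i, z i ≠ 0) → ¬ Nondegenerate z →
          z 0 * z 3 = z 1 * z 2 := by
        intro z hz hnd
        by_contra hne
        exact hnd ⟨mul_ne_zero (mul_ne_zero (mul_ne_zero (hz 0) (hz 1)) (hz 2)) (hz 3),
          sub_ne_zero.2 hne⟩
      have hx' := key x (fun i => (hx.1 i).2.1) hx.2
      have hy' := key y (fun i => (hy.1 i).2.1) hy.2
      simp only [Prod.mk.injEq] at hxy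
      obtain ⟨h0, h1, h2⟩ := hxy
      have h3 : x 3 = y 3 := by
        apply mul_left_cancel₀ (hx.1 0).2.1
        rw [hx', h1, h2, ← hy', h0]
      funext i
      fin_cases i <;> assumption
  rw [Finset.card_product, Finset.card_product, hI, hI, hI] at h
  linarith [h, show N ^ 3 = N * (N * N) by ring]

lemma count_failSet_le_add (s : Fin 4 → Bool) (N q : ℕ) :
    count s N (failSet q) ≤ count s N (failSet q ∩ {x | Nondegenerate x}) + N ^ 3 := by
  refine le_trans ?_ (Nat.add_le_add_left (count_degenerate_le s N) _)
  refine le_trans (Set.ncard_le_ncard ?_ ?_) (Set.ncard_union_le _ _)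
  · rintro x ⟨hx, hxq⟩
    by_cases h : Nondegenerate x
    · exact Or.inl ⟨hx, hxq, h⟩
    · exact Or.inr ⟨hx, h⟩
  · rw [← Set.inter_union_distrib_left]
    exact (box s N).finite_toSet.subset Set.inter_subset_left

/-- Passing to the limit in the box bound loses the degenerate vectors, which number at most `N ^
3`. -/
lemma density_failSet_le {q : ℕ} (hq : q ≠ 0) : density q (failSet q) ≤ weight q := by
  have : NeZero q := ⟨hq⟩
  have h1 := (periodic_failSet q).tendsto_count_div fun _ => true
  have h2 : Tendsto (fun N : ℕ => weight q + 1 / (N : ℝ)) atTop (𝓝 (weight q + 0)) :=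
    tendsto_const_nhds.add tendsto_one_div_atTop_nhds_zero_nat
  rw [add_zero] at h2
  refine le_of_tendsto_of_tendsto h1 h2 ?_
  filter_upwards [eventually_gt_atTop 0] with N hN
  have hN' : (0 : ℝ) < N := by exact_mod_cast hN
  rw [div_le_iff₀ (pow_pos hN' 4)]
  have h3 : (count (fun _ => true) N (failSet q) : ℝ) ≤
      count (fun _ => true) N (failSet q ∩ {x | Nondegenerate x}) + (N : ℝ) ^ 3 := by
    exact_mod_cast count_failSet_le_add (fun _ => true) N q
  calc _ ≤ weight q * (N : ℝ) ^ 4 + (N : ℝ) ^ 3 :=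
        h3.trans (add_le_add_left (count_failSet_le _ _ _) _)
    _ = _ := by field_simp

/-- The approximation of the number of nondegenerate points of `failSet q` in a box by the density,
uniformly in `q`. -/
lemma abs_count_failSet_sub_le (s : Fin 4 → Bool) {q : ℕ} (hq : q ≠ 0) {P : ℝ} (hP : 1 ≤ P) :
    |(count s ⌊P⌋₊ (failSet q ∩ {x | Nondegenerate x}) : ℝ) - density q (failSet q) * P ^ 4| ≤
      80 * P ^ (31 / 8 : ℝ) * majorant q +
        if q ∈ Finset.Ioc 0 ⌊P ^ (1 / 2 : ℝ)⌋₊ then P ^ 3 else 0 := by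
  have : NeZero q := ⟨hq⟩
  have hP0 : 0 < P := by linarith
  have hq0 : (0 : ℝ) < q := by exact_mod_cast Nat.pos_of_ne_zero hq
  have hN : ((⌊P⌋₊ : ℕ) : ℝ) ≤ P := Nat.floor_le hP0.le
  have hw := weight_nonneg q
  have hd := density_failSet_le hq
  have hd0 := density_nonneg q (failSet q)
  rw [majorant, if_neg hq]
  simp only [Finset.mem_Ioc, Nat.pos_of_ne_zero hq, true_and,
    Nat.le_floor_iff (Real.rpow_nonneg hP0.le (1 / 2))]
  split_ifs with hqP
  -- Small moduli: equidistribution has error `density * q * P ^ 3`, and `q ^ (3/4)` is absorbed by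
  -- the power of `P`. The extra `P ^ 3` pays for degenerate vectors, which `failSet q` may contain.
  · have hqP' : (q : ℝ) ≤ P := hqP.trans (by
      calc P ^ (1 / 2 : ℝ) ≤ P ^ (1 : ℝ) :=
            Real.rpow_le_rpow_of_exponent_le hP (by norm_num)
        _ = P := Real.rpow_one P)
    have h1 := (periodic_failSet q).abs_count_sub_le s hN (Nat.lt_floor_add_one P) hqP'
    have h2 : (count s ⌊P⌋₊ (failSet q) : ℝ) ≤
        count s ⌊P⌋₊ (failSet q ∩ {x | Nondegenerate x}) + (⌊P⌋₊ : ℝ) ^ 3 := by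
      exact_mod_cast count_failSet_le_add s ⌊P⌋₊ q
    have h3 : (count s ⌊P⌋₊ (failSet q ∩ {x | Nondegenerate x}) : ℝ) ≤
        count s ⌊P⌋₊ (failSet q) := by
      exact_mod_cast count_mono s _ Set.inter_subset_left
    have h4 : (⌊P⌋₊ : ℝ) ^ 3 ≤ P ^ 3 := by gcongr
    have h5 : density q (failSet q) * q * P ^ 3 ≤
        P ^ (31 / 8 : ℝ) * (weight q * (q : ℝ) ^ (1 / 4 : ℝ)) := by
      have hq34 : (q : ℝ) = (q : ℝ) ^ (3 / 4 : ℝ) * (q : ℝ) ^ (1 / 4 : ℝ) := by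
        rw [← Real.rpow_add hq0]; norm_num
      have hP34 : (q : ℝ) ^ (3 / 4 : ℝ) ≤ P ^ (7 / 8 : ℝ) := by
        calc (q : ℝ) ^ (3 / 4 : ℝ) ≤ (P ^ (1 / 2 : ℝ)) ^ (3 / 4 : ℝ) := by gcongr
          _ = P ^ (3 / 8 : ℝ) := by rw [← Real.rpow_mul hP0.le]; norm_num
          _ ≤ _ := Real.rpow_le_rpow_of_exponent_le hP (by norm_num)
      calc density q (failSet q) * q * P ^ 3
          = density q (failSet q) * ((q : ℝ) ^ (3 / 4 : ℝ) * (q : ℝ) ^ (1 / 4 : ℝ)) * P ^ 3 := by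
            rw [← hq34]
        _ ≤ weight q * (P ^ (7 / 8 : ℝ) * (q : ℝ) ^ (1 / 4 : ℝ)) * P ^ 3 := by gcongr
        _ = (P ^ (7 / 8 : ℝ) * P ^ (3 : ℝ)) * (weight q * (q : ℝ) ^ (1 / 4 : ℝ)) := by
            rw [show (3 : ℝ) = ((3 : ℕ) : ℝ) by norm_num, Real.rpow_natCast]; ring
        _ = _ := by rw [← Real.rpow_add hP0]; norm_num
    rw [abs_le] at h1 ⊢
    constructor <;> linarith
  -- Large moduli: count and main term are each at most `weight q * P ^ 4`, and `q > P ^ (1/2)`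
  -- gives `P ^ (1/8) ≤ q ^ (1/4)`.
  · rw [not_le] at hqP
    have h1 : (count s ⌊P⌋₊ (failSet q ∩ {x | Nondegenerate x}) : ℝ) ≤ weight q * P ^ 4 :=
      (count_failSet_le s _ q).trans (by gcongr)
    have h2 : weight q * P ^ 4 ≤ P ^ (31 / 8 : ℝ) * (weight q * (q : ℝ) ^ (1 / 4 : ℝ)) := by
      have : P ^ (1 / 8 : ℝ) ≤ (q : ℝ) ^ (1 / 4 : ℝ) := by
        calc P ^ (1 / 8 : ℝ) = (P ^ (1 / 2 : ℝ)) ^ (1 / 4 : ℝ) := by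
              rw [← Real.rpow_mul hP0.le]; norm_num
          _ ≤ _ := by gcongr
      calc weight q * P ^ 4 = P ^ (31 / 8 : ℝ) * (weight q * P ^ (1 / 8 : ℝ)) := by
            rw [mul_left_comm, ← Real.rpow_add hP0, ← Real.rpow_natCast]; norm_num
        _ ≤ _ := by gcongr
    have h3 : density q (failSet q) * P ^ 4 ≤ weight q * P ^ 4 := by gcongr
    have h4 : 0 ≤ density q (failSet q) * P ^ 4 := by positivity
    have h5 : (0 : ℝ) ≤ count s ⌊P⌋₊ (failSet q ∩ {x | Nondegenerate x}) := Nat.cast_nonneg _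
    rw [abs_le]
    constructor <;> linarith

/-! ### Inclusion-exclusion and the Euler product -/

/-- The integral vector `x` lies in `padicSoluble p` for every prime `p`. -/
def SolubleAtAllPrimes (x : Fin 4 → ℤ) : Prop :=
  ∀ (p : ℕ) [Fact p.Prime], (fun i => (x i : ℤ_[p])) ∈ padicSoluble p

/-- An odd failing prime divides a nonzero coefficient, so it is bounded by the size of the vector.
-/
lemma finite_failing_primes {x : Fin 4 → ℤ} (hx : Nondegenerate x) :
    {p : ℕ | p.Prime ∧ ∃ k, FailsAt p k x}.Finite := by
  refine Set.Finite.subset (Finset.range (2 + ∑ i, (x i).natAbs + 1)).finite_toSet ?_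
  rintro p ⟨hp, k, hk⟩
  have : Fact p.Prime := ⟨hp⟩
  rw [Finset.mem_coe, Finset.mem_range]
  by_cases hp2 : p = 2
  · omega
  · obtain ⟨i, j, -, hi, -⟩ := exists_two_dvd hp2 hx hk.notMem
    have h1 := Nat.le_of_dvd (Int.natAbs_pos.2 (hx.ne_zero i)) (Int.natCast_dvd.1 hi)
    have h2 : (x i).natAbs ≤ ∑ i, (x i).natAbs :=
      Finset.single_le_sum (f := fun i => (x i).natAbs) (fun _ _ => Nat.zero_le _)
        (Finset.mem_univ i)
    omega

lemma factorization_prod_pow {S : Finset ℕ} (hS : ∀ p ∈ S, p.Prime) (k : ℕ → ℕ) (p : ℕ) :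
    (∏ r ∈ S, r ^ k r).factorization p = if p ∈ S then k p else 0 := by
  rw [Nat.factorization_prod fun r hr => pow_ne_zero _ (hS r hr).ne_zero, Finsupp.finsetSum_apply]
  have : ∀ r ∈ S, (r ^ k r).factorization p = if p = r then k p else 0 := by
    intro r hr
    rw [(hS r hr).factorization_pow, Finsupp.single_apply]
    by_cases h : r = p
    · subst h; simp
    · simp [h, Ne.symm h]
  rw [Finset.sum_congr rfl this, Finset.sum_ite_eq]

open Classical in
/-- Inclusion and exclusion over the moduli at which `x` fails. -/
lemma hasSum_failSet {x : Fin 4 → ℤ} (hx : Nondegenerate x) :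
    HasSum (fun q : ℕ => if q ≠ 0 ∧ x ∈ failSet q then (-1 : ℝ) ^ q.primeFactors.card else 0)
      (if SolubleAtAllPrimes x then 1 else 0) := by
  let B : Finset ℕ := (finite_failing_primes hx).toFinset
  have hB : ∀ p, p ∈ B ↔ p.Prime ∧ ∃ k, FailsAt p k x := fun p => by simp [B]
  have hBp : ∀ p ∈ B, p.Prime := fun p hp => ((hB p).1 hp).1
  have hex : ∀ p, ∃ k, p ∈ B → FailsAt p k x := fun p => by
    by_cases hp : p ∈ B
    · obtain ⟨-, k, hk⟩ := (hB p).1 hp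
      exact ⟨k, fun _ => hk⟩
    · exact ⟨0, fun h => absurd h hp⟩
  choose k hk using hex
  have hk0 : ∀ p ∈ B, k p ≠ 0 := fun p hp => by
    have : Fact p.Prime := ⟨hBp p hp⟩
    exact (hk p hp).pos.ne'
  let F : Finset ℕ → ℕ := fun S => ∏ p ∈ S, p ^ k p
  have hFp : ∀ S ⊆ B, (F S).primeFactors = S := by
    intro S hS
    ext p
    rw [← Nat.support_factorization, Finsupp.mem_support_iff,
      factorization_prod_pow fun p hp => hBp p (hS hp)]
    constructor
    · intro h; by_contra hp; exact h (if_neg hp)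
    · intro h; rw [if_pos h]; exact hk0 p (hS h)
  have hF0 : ∀ S ⊆ B, F S ≠ 0 := fun S hS =>
    Finset.prod_ne_zero_iff.2 fun p hp => pow_ne_zero _ (hBp p (hS hp)).ne_zero
  have hFx : ∀ S ⊆ B, x ∈ failSet (F S) := by
    intro S hS p hp
    rw [hFp S hS] at hp
    rw [factorization_prod_pow fun p hp => hBp p (hS hp), if_pos hp]
    exact hk p (hS hp)
  -- Failure exponents are unique, so a modulus at which `x` fails is determined by its set of
  -- primes. The moduli thus correspond to the subsets of the finite set `B`, and the alternating
  -- sum vanishes unless `B` is empty.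
  have hback : ∀ q, q ≠ 0 → x ∈ failSet q → q.primeFactors ⊆ B ∧ F q.primeFactors = q := by
    intro q hq hxq
    have hsub : q.primeFactors ⊆ B := fun p hp =>
      (hB p).2 ⟨Nat.prime_of_mem_primeFactors hp, _, hxq p hp⟩
    refine ⟨hsub, ?_⟩
    conv_rhs => rw [← Nat.prod_factorization_pow_eq_self hq]
    rw [Finsupp.prod, Nat.support_factorization]
    refine Finset.prod_congr rfl fun p hp => ?_
    have : Fact p.Prime := ⟨Nat.prime_of_mem_primeFactors hp⟩
    rw [(hk p (hsub hp)).unique (hxq p hp)]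
  have hinj : Set.InjOn F (B.powerset : Set (Finset ℕ)) := by
    intro S hS S' hS' h
    rw [Finset.mem_coe, Finset.mem_powerset] at hS hS'
    rw [← hFp S hS, h, hFp S' hS']
  have hval : (if SolubleAtAllPrimes x then (1 : ℝ) else 0) =
      ∑ q ∈ B.powerset.image F,
        if q ≠ 0 ∧ x ∈ failSet q then (-1 : ℝ) ^ q.primeFactors.card else 0 := by
    rw [Finset.sum_image hinj]
    have h1 : ∀ S ∈ B.powerset, (if F S ≠ 0 ∧ x ∈ failSet (F S) then
        (-1 : ℝ) ^ (F S).primeFactors.card else 0) = (((-1 : ℤ) ^ S.card : ℤ) : ℝ) := by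
      intro S hS
      rw [Finset.mem_powerset] at hS
      rw [if_pos ⟨hF0 S hS, hFx S hS⟩, hFp S hS]
      push_cast
      rfl
    rw [Finset.sum_congr rfl h1, ← Int.cast_sum, Finset.sum_powerset_neg_one_pow_card]
    have h2 : SolubleAtAllPrimes x ↔ B = ∅ := by
      constructor
      · intro h
        refine Finset.eq_empty_of_forall_notMem fun p hp => ?_
        have : Fact p.Prime := ⟨hBp p hp⟩
        exact (hk p hp).notMem (h p)
      · intro h p hp
        by_contra hcon
        have : p ∈ B := (hB p).2 ⟨hp.out, exists_failsAt hx hcon⟩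
        rw [h] at this
        exact absurd this (Finset.notMem_empty p)
    by_cases h : B = ∅
    · rw [if_pos (h2.2 h), if_pos h]; simp
    · rw [if_neg (mt h2.1 h), if_neg h]; simp
  rw [hval]
  refine hasSum_sum_of_ne_finset_zero fun q hq => if_neg ?_
  rintro ⟨hq0, hxq⟩
  obtain ⟨h1, h2⟩ := hback q hq0 hxq
  exact hq (Finset.mem_image.2 ⟨_, Finset.mem_powerset.2 h1, h2⟩)

/-- The sign in the inclusion and exclusion, extended by `0` to `q = 0`. -/
noncomputable def sign (q : ℕ) : ℝ := if q = 0 then 0 else (-1) ^ q.primeFactors.card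

lemma abs_sign_le (q : ℕ) : |sign q| ≤ 1 := by
  unfold sign
  split_ifs <;> simp

/-- The vectors counted by `Nloc`, apart from the condition at the real place. -/
def solubleSet : Set (Fin 4 → ℤ) := {x | Nondegenerate x ∧ SolubleAtAllPrimes x}

lemma count_eq_card_filter (s : Fin 4 → Bool) (N : ℕ) {E : Set (Fin 4 → ℤ)}
    (φ : (Fin 4 → ℤ) → Prop) [DecidablePred φ] (h : ∀ x, x ∈ E ↔ φ x) :
    count s N E = ((box s N).filter φ).card := by
  rw [count, ← Set.ncard_coe_finset, Finset.coe_filter]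
  congr 1
  ext x
  simp [h x]

/-- The pointwise identity `hasSum_failSet` is summed over the finitely many nondegenerate vectors
in the box. -/
lemma hasSum_sign_mul_count (s : Fin 4 → Bool) (N : ℕ) :
    HasSum (fun q : ℕ => sign q * (count s N (failSet q ∩ {x | Nondegenerate x}) : ℝ))
      (count s N solubleSet) := by
  classical
  have h := hasSum_sum (s := (box s N).filter fun x => Nondegenerate x)
    (f := fun x q => if q ≠ 0 ∧ x ∈ failSet q then (-1 : ℝ) ^ q.primeFactors.card else 0)
    fun x hx => hasSum_failSet (Finset.mem_filter.1 hx).2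
  convert h using 1
  · funext q
    rw [← Finset.sum_filter, Finset.sum_const, nsmul_eq_mul, mul_comm, sign]
    by_cases hq : q = 0
    · simp [hq]
    · rw [if_neg hq, Finset.filter_filter,
        count_eq_card_filter s N fun x => Nondegenerate x ∧ q ≠ 0 ∧ x ∈ failSet q]
      intro x
      simp only [Set.mem_inter_iff, Set.mem_ofPred_eq, ne_eq, hq, not_false_eq_true, true_and]
      tauto
  · rw [← Finset.sum_filter, Finset.sum_const, nsmul_eq_mul, mul_one, Finset.filter_filter,
      count_eq_card_filter s N fun x => Nondegenerate x ∧ SolubleAtAllPrimes x]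
    exact fun x => Iff.rfl

lemma abs_sign_mul_density_le (q : ℕ) : |sign q * density q (failSet q)| ≤ majorant q := by
  by_cases hq : q = 0
  · simp [hq, sign, majorant]
  · rw [abs_mul, abs_of_nonneg (density_nonneg _ _), majorant, if_neg hq]
    have h1 : (1 : ℝ) ≤ (q : ℝ) ^ (1 / 4 : ℝ) :=
      Real.one_le_rpow (by exact_mod_cast Nat.pos_of_ne_zero hq) (by norm_num)
    have h2 := density_failSet_le hq
    have h3 := density_nonneg q (failSet q)
    calc |sign q| * density q (failSet q) ≤ 1 * density q (failSet q) := by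
          gcongr; exact abs_sign_le q
      _ ≤ weight q * 1 := by linarith
      _ ≤ _ := by have := weight_nonneg q; gcongr

/-- The Euler product for the signed sum of the densities. -/
lemma hasProd_tauPrime :
    HasProd (fun p : Nat.Primes =>
      (haveI : Fact (p : ℕ).Prime := ⟨p.2⟩; tauPrime (p : ℕ)))
      (∑' q, sign q * density q (failSet q)) := by
  let f : ℕ → ℝ := fun q => sign q * density q (failSet q)
  have hf0 : f 0 = 0 := by simp [f, sign]
  have hf1 : f 1 = 1 := by simp [f, sign, failSet_one, density_one_univ]
  have hmul : ∀ {m n : ℕ}, m.Coprime n → f (m * n) = f m * f n := by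
    intro m n h
    rcases eq_or_ne m 0 with rfl | hm
    · simp [f, sign]
    rcases eq_or_ne n 0 with rfl | hn
    · simp [f, sign]
    simp only [f, sign, hm, hn, mul_ne_zero hm hn, if_false, density_mul_failSet h hm hn,
      h.primeFactors_mul, Finset.card_union_of_disjoint h.disjoint_primeFactors, pow_add]
    ring
  have hsum : Summable fun q => ‖f q‖ := by
    exact summable_majorant.of_nonneg_of_le (fun q => norm_nonneg _) abs_sign_mul_density_le
  have h := EulerProduct.eulerProduct_hasProd hf1 hmul hsum hf0
  have htau : ∀ p : Nat.Primes, ∑' e : ℕ, f ((p : ℕ) ^ e) =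
      (haveI : Fact (p : ℕ).Prime := ⟨p.2⟩; tauPrime (p : ℕ)) := by
    intro p
    have hp : Fact (p : ℕ).Prime := ⟨p.2⟩
    have h1 := (hasSum_density_failSet (p := (p : ℕ))).neg
    -- Every positive power of `p` carries the sign `-1`, so the Euler factor is `1 - (1 - τ_p) =
    -- τ_p`.
    have h2 : HasSum (fun k : ℕ => f ((p : ℕ) ^ (k + 1))) (-(1 - tauPrime (p : ℕ))) := by
      refine h1.congr_fun fun k => ?_
      simp [f, sign, p.2.ne_zero, Nat.primeFactors_prime_pow (Nat.succ_ne_zero k) p.2]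
    have h3 := (hasSum_nat_add_iff (f := fun k : ℕ => f ((p : ℕ) ^ k)) 1).1 h2
    rw [h3.tsum_eq]
    simp [hf1]
  simp only [htau] at h
  exact h

/-- The number of soluble vectors in a box. -/
lemma exists_abs_count_solubleSet_sub_le : ∃ C : ℝ, ∀ (s : Fin 4 → Bool) (P : ℝ), 1 ≤ P →
    |(count s ⌊P⌋₊ solubleSet : ℝ) - (∏' p : Nat.Primes,
      (haveI : Fact (p : ℕ).Prime := ⟨p.2⟩; tauPrime (p : ℕ))) * P ^ 4| ≤
      C * P ^ (31 / 8 : ℝ) := by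
  refine ⟨80 * (∑' q, majorant q) + 1, fun s P hP => ?_⟩
  have hP0 : 0 < P := by linarith
  rw [hasProd_tauPrime.tprod_eq]
  have hsd : Summable fun q => sign q * density q (failSet q) :=
    summable_majorant.of_norm_bounded abs_sign_mul_density_le
  have h1 := (hasSum_sign_mul_count s ⌊P⌋₊).sub (hsd.hasSum.mul_right (P ^ 4))
  have h2 : HasSum (fun q : ℕ => 80 * P ^ (31 / 8 : ℝ) * majorant q +
      if q ∈ Finset.Ioc 0 ⌊P ^ (1 / 2 : ℝ)⌋₊ then P ^ 3 else 0)
      (80 * P ^ (31 / 8 : ℝ) * (∑' q, majorant q) +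
        ∑ q ∈ Finset.Ioc 0 ⌊P ^ (1 / 2 : ℝ)⌋₊, P ^ 3) := by
    refine (summable_majorant.hasSum.mul_left _).add ?_
    have := hasSum_sum_of_ne_finset_zero (L := .unconditional ℕ)
      (s := Finset.Ioc 0 ⌊P ^ (1 / 2 : ℝ)⌋₊)
      (f := fun q => if q ∈ Finset.Ioc 0 ⌊P ^ (1 / 2 : ℝ)⌋₊ then P ^ 3 else 0)
      fun q hq => if_neg hq
    rwa [Finset.sum_congr rfl fun q hq => if_pos hq] at this
  have h3 := tsum_of_norm_bounded h2 (f := fun q : ℕ =>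
      sign q * (count s ⌊P⌋₊ (failSet q ∩ {x | Nondegenerate x}) : ℝ) -
        sign q * density q (failSet q) * P ^ 4) fun q => by
    by_cases hq : q = 0
    · subst hq
      have := majorant_nonneg 0
      simp [sign]
      positivity
    · refine le_trans ?_ (abs_count_failSet_sub_le s hq hP)
      rw [Real.norm_eq_abs, mul_assoc, ← mul_sub, abs_mul]
      exact mul_le_of_le_one_left (abs_nonneg _) (abs_sign_le q)
  rw [h1.tsum_eq, Real.norm_eq_abs] at h3
  refine h3.trans ?_
  have h4 : ∑ q ∈ Finset.Ioc 0 ⌊P ^ (1 / 2 : ℝ)⌋₊, P ^ 3 ≤ P ^ (31 / 8 : ℝ) := by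
    rw [Finset.sum_const, nsmul_eq_mul, Nat.card_Ioc, Nat.sub_zero]
    calc (⌊P ^ (1 / 2 : ℝ)⌋₊ : ℝ) * P ^ 3 ≤ P ^ (1 / 2 : ℝ) * P ^ 3 := by
          gcongr; exact Nat.floor_le (by positivity)
      _ = P ^ (7 / 2 : ℝ) := by
          rw [← Real.rpow_natCast, ← Real.rpow_add hP0]; norm_num
      _ ≤ _ := Real.rpow_le_rpow_of_exponent_le hP (by norm_num)
  linarith

/-! ### The real place -/

/-- The excluded patterns make the two factors definite of opposite signs, so the product is
negative. Otherwise `ac ≥ 0` or `bd ≥ 0` gives a point above `v = 0` or `u = 0`; if both are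
negative, `ab < 0` and the first factor has a real zero. -/
lemma hasPoint_real_iff {x : Fin 4 → ℝ} (hx : ∀ i, x i ≠ 0) :
    HasPoint ℝ x ↔ ¬ (0 < x 0 ∧ 0 < x 1 ∧ x 2 < 0 ∧ x 3 < 0) ∧
      ¬ (x 0 < 0 ∧ x 1 < 0 ∧ 0 < x 2 ∧ 0 < x 3) := by
  constructor
  · rintro ⟨u, v, y, z, w, huv, hyzw, h⟩
    have hposdef : ∀ a b : ℝ, 0 < a → 0 < b → 0 < a * u ^ 2 + b * v ^ 2 := by
      intro a b ha hb
      rcases huv with h | h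
      · have := pow_pos (abs_pos.2 h) 2
        rw [sq_abs] at this
        positivity
      · have := pow_pos (abs_pos.2 h) 2
        rw [sq_abs] at this
        positivity
    have key : ¬ (x 0 * u ^ 2 + x 1 * v ^ 2) * (x 2 * u ^ 2 + x 3 * v ^ 2) < 0 := by
      intro hneg
      have hw : w = 0 := by
        by_contra hw
        have : 0 < w ^ 2 := by positivity
        nlinarith [sq_nonneg y, sq_nonneg z]
      rw [hw] at h
      have hy : y = 0 := by nlinarith [sq_nonneg y, sq_nonneg z]
      have hz : z = 0 := by nlinarith [sq_nonneg y, sq_nonneg z]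
      simp [hw, hy, hz] at hyzw
    constructor
    · rintro ⟨h0, h1, h2, h3⟩
      have := hposdef _ _ (neg_pos.2 h2) (neg_pos.2 h3)
      exact key (mul_neg_of_pos_of_neg (hposdef _ _ h0 h1) (by linarith))
    · rintro ⟨h0, h1, h2, h3⟩
      have := hposdef _ _ (neg_pos.2 h0) (neg_pos.2 h1)
      exact key (mul_neg_of_neg_of_pos (by linarith) (hposdef _ _ h2 h3))
  · rintro ⟨h1, h2⟩
    by_cases h02 : 0 ≤ x 0 * x 2
    · exact ⟨1, 0, √(x 0 * x 2), 0, 1, by simp, by simp, by simp [Real.sq_sqrt h02]⟩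
    by_cases h13 : 0 ≤ x 1 * x 3
    · exact ⟨0, 1, √(x 1 * x 3), 0, 1, by simp, by simp, by simp [Real.sq_sqrt h13]⟩
    have h01 : x 0 * x 1 < 0 := by
      by_contra h01
      rw [not_le] at h02 h13
      have h01' : 0 < x 0 * x 1 :=
        lt_of_le_of_ne (not_lt.1 h01) (mul_ne_zero (hx 0) (hx 1)).symm
      rcases lt_or_gt_of_ne (hx 0) with h | h
      · have hb := neg_of_mul_pos_right h01' h.le
        exact h2 ⟨h, hb, pos_of_mul_neg_right h02 h.le, pos_of_mul_neg_right h13 hb.le⟩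
      · have hb := pos_of_mul_pos_right h01' h.le
        exact h1 ⟨h, hb, neg_of_mul_neg_right h02 h.le, neg_of_mul_neg_right h13 hb.le⟩
    refine hasPoint_of_isotropic_left (u := √(-(x 0 * x 1))) (v := x 0) (Or.inr (hx 0)) ?_
    rw [Real.sq_sqrt (by linarith)]
    ring

lemma volume_degenerate : volume {x : Fin 4 → ℝ | ¬ Nondegenerate x} = 0 := by
  -- By Fubini: for fixed `a ≠ 0`, `b`, `c` the equation `ad = bc` leaves a single value of `d`.
  have hdet : volume {x : Fin 4 → ℝ | x 0 ≠ 0 ∧ x 0 * x 3 = x 1 * x 2} = 0 := by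
    let S : Set (ℝ × (Fin 3 → ℝ)) := {z | z.2 0 ≠ 0 ∧ z.2 0 * z.1 = z.2 1 * z.2 2}
    have hS : MeasurableSet S := by
      refine MeasurableSet.inter ?_ ?_
      · exact (measurableSet_eq_fun (by fun_prop) measurable_const).compl
      · exact measurableSet_eq_fun (by fun_prop) (by fun_prop)
    have hpre : {x : Fin 4 → ℝ | x 0 ≠ 0 ∧ x 0 * x 3 = x 1 * x 2} =
        (MeasurableEquiv.piFinSuccAbove (fun _ => ℝ) (3 : Fin 4)) ⁻¹' S := by
      ext x
      rfl
    rw [hpre, (volume_preserving_piFinSuccAbove (fun _ => ℝ) (3 : Fin 4)).measure_preimage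
      hS.nullMeasurableSet, Measure.volume_eq_prod, Measure.prod_apply_symm hS]
    rw [lintegral_eq_zero_of_ae_eq_zero]
    refine Eventually.of_forall fun f => ?_
    refine measure_mono_null (t := {f 1 * f 2 / f 0}) ?_ (measure_singleton _)
    rintro t ⟨h1, h2⟩
    rw [Set.mem_singleton_iff, eq_div_iff h1, ← h2]
    ring
  have hcoord : ∀ i : Fin 4, volume {x : Fin 4 → ℝ | x i = 0} = 0 := fun i => by
    rw [volume_pi]
    exact Measure.pi_hyperplane _ i 0
  refine measure_mono_null (t := (⋃ i : Fin 4, {x : Fin 4 → ℝ | x i = 0}) ∪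
    {x : Fin 4 → ℝ | x 0 ≠ 0 ∧ x 0 * x 3 = x 1 * x 2}) ?_
    (measure_union_null (measure_iUnion_null hcoord) hdet)
  intro x hx
  by_contra hcon
  simp only [Set.mem_union, Set.mem_iUnion, Set.mem_ofPred_eq, not_or, not_exists, not_and] at hcon
  refine hx ⟨?_, sub_ne_zero.2 (hcon.2 (hcon.1 0))⟩
  exact mul_ne_zero (mul_ne_zero (mul_ne_zero (hcon.1 0) (hcon.1 1)) (hcon.1 2)) (hcon.1 3)

/-- Up to a null set, two of the sixteen unit orthants of the cube are removed: `(16 - 2) / 8`. -/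
lemma tauInfinity_eq : tauInfinity = 7 / 4 := by
  let B : Set (Fin 4 → ℝ) := Set.univ.pi fun _ => Set.Icc (-1) 1
  let G₁ : Set (Fin 4 → ℝ) :=
    Set.univ.pi ![Set.Ioc 0 1, Set.Ioc 0 1, Set.Ico (-1) 0, Set.Ico (-1) 0]
  let G₂ : Set (Fin 4 → ℝ) :=
    Set.univ.pi ![Set.Ico (-1) 0, Set.Ico (-1) 0, Set.Ioc 0 1, Set.Ioc 0 1]
  have hB : volume B = 16 := by
    rw [volume_pi_pi]
    norm_num [Real.volume_Icc, Fin.prod_univ_four]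
  have hG₁ : volume G₁ = 1 := by
    rw [volume_pi_pi]
    simp only [Fin.prod_univ_four, Matrix.cons_val, Real.volume_Ioc, Real.volume_Ico]
    norm_num
  have hG₂ : volume G₂ = 1 := by
    rw [volume_pi_pi]
    simp only [Fin.prod_univ_four, Matrix.cons_val, Real.volume_Ioc, Real.volume_Ico]
    norm_num
  have hm₁ : MeasurableSet G₁ := by
    refine MeasurableSet.univ_pi fun i => ?_
    fin_cases i <;> simp
  have hm₂ : MeasurableSet G₂ := by
    refine MeasurableSet.univ_pi fun i => ?_
    fin_cases i <;> simp
  have hmem₁ : ∀ x, x ∈ G₁ ↔ (0 < x 0 ∧ x 0 ≤ 1) ∧ (0 < x 1 ∧ x 1 ≤ 1) ∧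
      (-1 ≤ x 2 ∧ x 2 < 0) ∧ (-1 ≤ x 3 ∧ x 3 < 0) := fun x => by
    simp [G₁, Fin.forall_fin_succ]
  have hmem₂ : ∀ x, x ∈ G₂ ↔ (-1 ≤ x 0 ∧ x 0 < 0) ∧ (-1 ≤ x 1 ∧ x 1 < 0) ∧
      (0 < x 2 ∧ x 2 ≤ 1) ∧ (0 < x 3 ∧ x 3 ≤ 1) := fun x => by
    simp [G₂, Fin.forall_fin_succ]
  have hset : {x : Fin 4 → ℝ | (∀ i, |x i| ≤ 1) ∧ Nondegenerate x ∧ HasPoint ℝ x} =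
      (B \ (G₁ ∪ G₂)) \ {x | ¬ Nondegenerate x} := by
    ext x
    simp only [Set.mem_ofPred_eq, Set.mem_sdiff, Set.mem_union, hmem₁, hmem₂, not_not, B,
      Set.mem_univ_pi, Set.mem_Icc, ← abs_le]
    constructor
    · rintro ⟨h1, h2, h3⟩
      rw [hasPoint_real_iff h2.ne_zero] at h3
      exact ⟨⟨h1, by tauto⟩, h2⟩
    · rintro ⟨⟨h1, h2⟩, h3⟩
      refine ⟨h1, h3, (hasPoint_real_iff h3.ne_zero).2 ?_⟩
      have h4 : ∀ i, -1 ≤ x i ∧ x i ≤ 1 := fun i => abs_le.1 (h1 i)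
      have h40 := h4 0; have h41 := h4 1; have h42 := h4 2; have h43 := h4 3
      tauto
  have hdisj : Disjoint G₁ G₂ := by
    rw [Set.disjoint_left]
    intro x h1 h2
    have := ((hmem₁ x).1 h1).1.1
    have := ((hmem₂ x).1 h2).1.2
    linarith
  have hsub : G₁ ∪ G₂ ⊆ B := by
    intro x hx i _
    rw [Set.mem_Icc]
    rcases hx with h | h
    · rw [hmem₁] at h
      fin_cases i <;> simp <;> constructor <;> linarith [h.1.1, h.1.2, h.2.1.1, h.2.1.2,
        h.2.2.1.1, h.2.2.1.2, h.2.2.2.1, h.2.2.2.2]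
    · rw [hmem₂] at h
      fin_cases i <;> simp <;> constructor <;> linarith [h.1.1, h.1.2, h.2.1.1, h.2.1.2,
        h.2.2.1.1, h.2.2.1.2, h.2.2.2.1, h.2.2.2.2]
  have hG : volume (G₁ ∪ G₂) = 2 := by
    rw [measure_union hdisj hm₂, hG₁, hG₂]; norm_num
  rw [tauInfinity, hset, measure_sdiff_null volume_degenerate,
    measure_sdiff hsub (hm₁.union hm₂).nullMeasurableSet (by rw [hG]; norm_num), hB, hG,
    ENNReal.toReal_sub_of_le (by norm_num) (by norm_num)]
  norm_num

/-! ### Invariance of solubility on classes -/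

section Invariance

variable {K : Type*} [Field K]

/-- The substitution rescales `u`, `v` by `l`, `m` and multiplies `y + iz` by `t ξ η`, whose norm is
the factor by which the right-hand side changes. The converse uses the conjugate and rescales `w`,
which avoids dividing by the norm. -/
lemma hasPoint_torus_iff {x y : Fin 4 → K} {t l m ξ₁ ξ₂ η₁ η₂ : K}
    (ht : t ≠ 0) (hl : l ≠ 0) (hm : m ≠ 0) (hξ : ξ₁ ^ 2 + ξ₂ ^ 2 ≠ 0) (hη : η₁ ^ 2 + η₂ ^ 2 ≠ 0)
    (h0 : y 0 = t * l ^ 2 * (ξ₁ ^ 2 + ξ₂ ^ 2) * x 0)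
    (h1 : y 1 = t * m ^ 2 * (ξ₁ ^ 2 + ξ₂ ^ 2) * x 1)
    (h2 : y 2 = t * l ^ 2 * (η₁ ^ 2 + η₂ ^ 2) * x 2)
    (h3 : y 3 = t * m ^ 2 * (η₁ ^ 2 + η₂ ^ 2) * x 3) : HasPoint K x ↔ HasPoint K y := by
  have hmulne : ∀ α β Y Z W : K, α ^ 2 + β ^ 2 ≠ 0 → (Y ≠ 0 ∨ Z ≠ 0 ∨ W ≠ 0) →
      ∀ W' : K, (W' = 0 → W = 0) → (α * Y - β * Z ≠ 0 ∨ α * Z + β * Y ≠ 0 ∨ W' ≠ 0) := by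
    intro α β Y Z W hN h W' hW
    by_contra! hcon
    obtain ⟨e1, e2, e3⟩ := hcon
    have hY : Y = 0 := by
      have : (α ^ 2 + β ^ 2) * Y = 0 := by linear_combination α * e1 + β * e2
      exact (mul_eq_zero.1 this).resolve_left hN
    have hZ : Z = 0 := by
      have : (α ^ 2 + β ^ 2) * Z = 0 := by linear_combination α * e2 - β * e1
      exact (mul_eq_zero.1 this).resolve_left hN
    exact absurd h (by simp [hY, hZ, hW e3])
  have hN : (t * (ξ₁ * η₁ - ξ₂ * η₂)) ^ 2 + (t * (ξ₁ * η₂ + ξ₂ * η₁)) ^ 2 ≠ 0 := by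
    rw [show (t * (ξ₁ * η₁ - ξ₂ * η₂)) ^ 2 + (t * (ξ₁ * η₂ + ξ₂ * η₁)) ^ 2 =
      t ^ 2 * ((ξ₁ ^ 2 + ξ₂ ^ 2) * (η₁ ^ 2 + η₂ ^ 2)) by ring]
    exact mul_ne_zero (pow_ne_zero 2 ht) (mul_ne_zero hξ hη)
  constructor
  · rintro ⟨u, v, Y, Z, W, huv, hYZW, h⟩
    refine ⟨u / l, v / m, _, _, W, by simpa [hl, hm] using huv,
      hmulne _ _ Y Z W hN hYZW W id, ?_⟩
    rw [h0, h1, h2, h3]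
    field_simp
    linear_combination ((ξ₁ ^ 2 + ξ₂ ^ 2) * (η₁ ^ 2 + η₂ ^ 2)) * h
  · rintro ⟨u, v, Y, Z, W, huv, hYZW, h⟩
    have hN' : (t * (ξ₁ * η₁ - ξ₂ * η₂)) ^ 2 + (-(t * (ξ₁ * η₂ + ξ₂ * η₁))) ^ 2 ≠ 0 := by
      rwa [neg_sq]
    refine ⟨l * u, m * v, _, _, t ^ 2 * ((ξ₁ ^ 2 + ξ₂ ^ 2) * (η₁ ^ 2 + η₂ ^ 2)) * W,
      by simpa [hl, hm] using huv, hmulne _ _ Y Z W hN' hYZW _ ?_, ?_⟩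
    · intro h'
      simpa [ht, hξ, hη] using h'
    · rw [h0, h1, h2, h3] at h
      linear_combination (t ^ 2 * ((ξ₁ ^ 2 + ξ₂ ^ 2) * (η₁ ^ 2 + η₂ ^ 2))) * h

lemma hasPoint_of_step [CharZero K] {x y : Coeffs} (h : Step x y) :
    HasPoint K (fun i => (x.1 i : K)) ↔ HasPoint K (fun i => (y.1 i : K)) := by
  cases h with
  | torus t l m ξ₁ ξ₂ η₁ η₂ h =>
    have e0 : y.1 0 = t * l ^ 2 * (ξ₁ ^ 2 + ξ₂ ^ 2) * x.1 0 := by rw [h]; rfl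
    have e1 : y.1 1 = t * m ^ 2 * (ξ₁ ^ 2 + ξ₂ ^ 2) * x.1 1 := by rw [h]; rfl
    have e2 : y.1 2 = t * l ^ 2 * (η₁ ^ 2 + η₂ ^ 2) * x.1 2 := by rw [h]; rfl
    have e3 : y.1 3 = t * m ^ 2 * (η₁ ^ 2 + η₂ ^ 2) * x.1 3 := by rw [h]; rfl
    -- `Step.torus` does not ask for nonzero parameters; this follows from the coefficients of `y`
    -- being nonzero.
    have n0 := y.2.ne_zero 0
    have n1 := y.2.ne_zero 1
    have n2 := y.2.ne_zero 2
    rw [e0] at n0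
    rw [e1] at n1
    rw [e2] at n2
    simp only [ne_eq, mul_eq_zero, not_or, pow_eq_zero_iff two_ne_zero] at n0 n1 n2
    refine hasPoint_torus_iff (t := (t : K)) (l := l) (m := m) (ξ₁ := ξ₁) (ξ₂ := ξ₂) (η₁ := η₁)
      (η₂ := η₂) (by exact_mod_cast n0.1.1.1) (by exact_mod_cast n0.1.1.2)
      (by exact_mod_cast n1.1.1.2) (by exact_mod_cast n0.1.2) (by exact_mod_cast n2.1.2)
      ?_ ?_ ?_ ?_
    · simp only [e0]; push_cast; rfl
    · simp only [e1]; push_cast; rfl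
    · simp only [e2]; push_cast; rfl
    · simp only [e3]; push_cast; rfl
  | swapFactors h =>
    have e0 : y.1 0 = x.1 2 := by rw [h]; rfl
    have e1 : y.1 1 = x.1 3 := by rw [h]; rfl
    have e2 : y.1 2 = x.1 0 := by rw [h]; rfl
    have e3 : y.1 3 = x.1 1 := by rw [h]; rfl
    simp only [HasPoint, e0, e1, e2, e3]
    refine exists_congr fun u => exists_congr fun v => exists_congr fun Y => exists_congr fun Z =>
      exists_congr fun W => ?_
    rw [mul_comm ((x.1 0 : K) * u ^ 2 + x.1 1 * v ^ 2)]
  | swapVariables h =>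
    have e0 : y.1 0 = x.1 1 := by rw [h]; rfl
    have e1 : y.1 1 = x.1 0 := by rw [h]; rfl
    have e2 : y.1 2 = x.1 3 := by rw [h]; rfl
    have e3 : y.1 3 = x.1 2 := by rw [h]; rfl
    simp only [HasPoint, e0, e1, e2, e3]
    rw [exists_comm]
    refine exists_congr fun u => exists_congr fun v => exists_congr fun Y => exists_congr fun Z =>
      exists_congr fun W => ?_
    rw [or_comm, add_comm ((x.1 0 : K) * v ^ 2), add_comm ((x.1 2 : K) * v ^ 2)]

end Invariance

lemma everywhereLocallySoluble_of_step {x y : Coeffs} (h : Step x y) :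
    EverywhereLocallySoluble x.1 ↔ EverywhereLocallySoluble y.1 := by
  unfold EverywhereLocallySoluble
  rw [hasPoint_of_step h]
  refine and_congr_right fun _ => forall_congr' fun p => forall_congr' fun hp => ?_
  exact hasPoint_of_step h

lemma everywhereLocallySoluble_of_mk_eq {x y : Coeffs} (h : Quot.mk Step x = Quot.mk Step y) :
    EverywhereLocallySoluble x.1 ↔ EverywhereLocallySoluble y.1 := by
  have := congrArg (Quot.lift (fun z : Coeffs => EverywhereLocallySoluble z.1)
    fun a b hab => propext (everywhereLocallySoluble_of_step hab)) h
  exact iff_of_eq this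

/-! ### Reducedness as a condition at each prime -/

lemma dvd_intGcd_iff {d : ℕ} {a b : ℤ} : d ∣ Int.gcd a b ↔ (d : ℤ) ∣ a ∧ (d : ℤ) ∣ b := by
  rw [Int.gcd, Nat.dvd_gcd_iff, Int.natCast_dvd, Int.natCast_dvd]

lemma squarefree_intGcd_iff {a b : ℤ} : Squarefree (Int.gcd a b) ↔
    ∀ p : ℕ, p.Prime → ¬ ((p : ℤ) ^ 2 ∣ a ∧ (p : ℤ) ^ 2 ∣ b) := by
  rw [Nat.squarefree_iff_prime_squarefree]
  refine forall_congr' fun p => forall_congr' fun _ => ?_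
  rw [← sq, dvd_intGcd_iff]
  push_cast
  rfl

lemma squarefreeThreeModFour_intGcd_iff {a b : ℤ} : SquarefreeThreeModFour (Int.gcd a b) ↔
    ∀ p : ℕ, p.Prime → ¬ ((p : ℤ) ^ (delta p + 1) ∣ a ∧ (p : ℤ) ^ (delta p + 1) ∣ b) := by
  rw [SquarefreeThreeModFour, squarefree_intGcd_iff]
  constructor
  · rintro ⟨h1, h2⟩ p hp h
    unfold delta at h
    split_ifs at h with hp3
    · exact h1 p hp h
    · rw [zero_add, pow_one] at h
      exact hp3 (h2 p hp (dvd_intGcd_iff.2 h))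
  · intro h
    refine ⟨fun p hp hd => h p hp ?_, fun p hp hd => ?_⟩
    · have hle : delta p + 1 ≤ 2 := by unfold delta; split_ifs <;> norm_num
      exact ⟨(pow_dvd_pow _ hle).trans hd.1, (pow_dvd_pow _ hle).trans hd.2⟩
    · by_contra hp3
      have := h p hp
      rw [delta, if_neg hp3, zero_add, pow_one] at this
      exact this (dvd_intGcd_iff.1 hd)

lemma gcd_intGcd_eq_one_iff {x : Fin 4 → ℤ} :
    Nat.gcd (Int.gcd (x 0) (x 1)) (Int.gcd (x 2) (x 3)) = 1 ↔
      ∀ p : ℕ, p.Prime → ∃ i, ¬ (p : ℤ) ∣ x i := by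
  constructor
  · intro h p hp
    by_contra! hcon
    have : p ∣ Nat.gcd (Int.gcd (x 0) (x 1)) (Int.gcd (x 2) (x 3)) :=
      Nat.dvd_gcd (dvd_intGcd_iff.2 ⟨hcon 0, hcon 1⟩) (dvd_intGcd_iff.2 ⟨hcon 2, hcon 3⟩)
    rw [h] at this
    exact hp.one_lt.ne' (Nat.dvd_one.1 this)
  · intro h
    refine Nat.coprime_of_dvd fun p hp h1 h2 => ?_
    rw [dvd_intGcd_iff] at h1 h2
    obtain ⟨i, hi⟩ := h p hp
    fin_cases i
    exacts [hi h1.1, hi h1.2, hi h2.1, hi h2.2]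

lemma mem_padicSoluble_intCast_iff {p : ℕ} [Fact p.Prime] {x : Fin 4 → ℤ} :
    (fun i => (x i : ℤ_[p])) ∈ padicSoluble p ↔
      Nondegenerate x ∧ HasPoint ℚ_[p] (fun i => ((x i : ℚ) : ℚ_[p])) ∧
      (∃ i, ¬ (p : ℤ) ∣ x i) ∧
      ¬ ((p : ℤ) ^ 2 ∣ x 0 ∧ (p : ℤ) ^ 2 ∣ x 2) ∧
      ¬ ((p : ℤ) ^ 2 ∣ x 1 ∧ (p : ℤ) ^ 2 ∣ x 3) ∧
      ¬ ((p : ℤ) ^ (delta p + 1) ∣ x 0 ∧ (p : ℤ) ^ (delta p + 1) ∣ x 1) ∧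
      ¬ ((p : ℤ) ^ (delta p + 1) ∣ x 2 ∧ (p : ℤ) ^ (delta p + 1) ∣ x 3) := by
  have hnd : Nondegenerate (fun i => (x i : ℤ_[p])) ↔ Nondegenerate x := by
    refine ⟨fun h => ?_, fun h => h.intCast⟩
    obtain ⟨h1, h2⟩ := h
    dsimp only at h1 h2
    exact ⟨by exact_mod_cast h1, by exact_mod_cast h2⟩
  have h1 : ∀ i, (p : ℤ_[p]) ∣ (x i : ℤ_[p]) ↔ (p : ℤ) ∣ x i := fun i => by
    have := intCast_pow_dvd_iff (p := p) (n := 1) (a := x i)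
    rwa [pow_one, pow_one] at this
  simp only [padicSoluble, Set.mem_ofPred_eq, intCast_pow_dvd_iff, h1, hnd, PadicInt.coe_intCast,
    Rat.cast_intCast]

/-- A vector is reduced and everywhere locally soluble if and only if it is so at each place. -/
lemma isReduced_and_soluble_iff {x : Fin 4 → ℤ} :
    (IsReduced x ∧ EverywhereLocallySoluble fun i => (x i : ℚ)) ↔
      0 < x 0 ∧ HasPoint ℝ (fun i => (x i : ℝ)) ∧ x ∈ solubleSet := by
  constructor
  · rintro ⟨⟨h0, hnd, hprim, hac, hbd, hab, hcd⟩, hR, hp⟩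
    refine ⟨h0, by simpa using hR, hnd, fun p hpp => ?_⟩
    rw [mem_padicSoluble_intCast_iff]
    rw [gcd_intGcd_eq_one_iff] at hprim
    rw [squarefree_intGcd_iff] at hac hbd
    rw [squarefreeThreeModFour_intGcd_iff] at hab hcd
    exact ⟨hnd, hp p, hprim p hpp.out, hac p hpp.out, hbd p hpp.out, hab p hpp.out, hcd p hpp.out⟩
  · rintro ⟨h0, hR, hnd, h⟩
    have H := fun (p : ℕ) (hp : Fact p.Prime) => mem_padicSoluble_intCast_iff.1 (h p)
    refine ⟨⟨h0, hnd, ?_, ?_, ?_, ?_, ?_⟩, by simpa using hR, fun p hp => (H p hp).2.1⟩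
    · exact gcd_intGcd_eq_one_iff.2 fun p hp => (H p ⟨hp⟩).2.2.1
    · exact squarefree_intGcd_iff.2 fun p hp => (H p ⟨hp⟩).2.2.2.1
    · exact squarefree_intGcd_iff.2 fun p hp => (H p ⟨hp⟩).2.2.2.2.1
    · exact squarefreeThreeModFour_intGcd_iff.2 fun p hp => (H p ⟨hp⟩).2.2.2.2.2.1
    · exact squarefreeThreeModFour_intGcd_iff.2 fun p hp => (H p ⟨hp⟩).2.2.2.2.2.2

/-- The signs of the coefficients `(a, b, c, d)` with `a > 0` for which there are real points. -/
def realSigns : Finset (Fin 4 → Bool) :=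
  Finset.univ.filter fun s => s 0 = true ∧ ¬ (s 1 = true ∧ s 2 = false ∧ s 3 = false)

lemma card_realSigns : realSigns.card = 7 := by decide

lemma hasPoint_real_iff_mem_realSigns {s : Fin 4 → Bool} {N : ℕ} {x : Fin 4 → ℤ}
    (hx : x ∈ box s N) : (0 < x 0 ∧ HasPoint ℝ (fun i => (x i : ℝ))) ↔ s ∈ realSigns := by
  rw [mem_box_iff] at hx
  rw [hasPoint_real_iff fun i => by exact_mod_cast (hx i).2.1]
  simp only [Int.cast_pos, Int.cast_lt_zero]
  have hpos : ∀ i, 0 < x i ↔ s i = true := fun i => (hx i).2.2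
  have hneg : ∀ i, x i < 0 ↔ s i = false := fun i => by
    rw [← Bool.not_eq_true, ← hpos i]
    have := (hx i).2.1
    omega
  simp only [hpos, hneg, realSigns, Finset.mem_filter, Finset.mem_univ, true_and]
  cases s 0 <;> cases s 1 <;> cases s 2 <;> cases s 3 <;> simp

/-! ### From classes to vectors -/

/-- The vectors counted by `Nloc`. -/
def countedSet (P : ℝ) : Set (Fin 4 → ℤ) :=
  {x | (IsReduced x ∧ EverywhereLocallySoluble fun i => (x i : ℚ)) ∧ ∀ i, |(x i : ℝ)| ≤ P}

lemma countedSet_eq_biUnion {P : ℝ} (hP : 0 ≤ P) :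
    countedSet P = ⋃ s ∈ realSigns, ((box s ⌊P⌋₊ : Set (Fin 4 → ℤ)) ∩ solubleSet) := by
  have habs : ∀ a : ℤ, |(a : ℝ)| ≤ P ↔ a.natAbs ≤ ⌊P⌋₊ := fun a => by
    rw [Nat.le_floor_iff hP, Nat.cast_natAbs, Int.cast_abs]
  ext x
  simp only [countedSet, Set.mem_ofPred_eq, isReduced_and_soluble_iff, Set.mem_iUnion,
    Set.mem_inter_iff, Finset.mem_coe, exists_prop, habs]
  constructor
  · rintro ⟨⟨h0, hR, hs⟩, hb⟩
    have hbox : x ∈ box (fun i => decide (0 < x i)) ⌊P⌋₊ :=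
      mem_box_iff.2 fun i => ⟨hb i, hs.1.ne_zero i, by simp⟩
    exact ⟨_, (hasPoint_real_iff_mem_realSigns hbox).1 ⟨h0, hR⟩, hbox, hs⟩
  · rintro ⟨s, hs, hbox, hsol⟩
    obtain ⟨h0, hR⟩ := (hasPoint_real_iff_mem_realSigns hbox).2 hs
    exact ⟨⟨h0, hR, hsol⟩, fun i => (mem_box_iff.1 hbox i).1⟩

lemma finite_countedSet {P : ℝ} (hP : 0 ≤ P) : (countedSet P).Finite := by
  rw [countedSet_eq_biUnion hP]
  exact realSigns.finite_toSet.biUnion fun s _ =>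
    (box s ⌊P⌋₊).finite_toSet.subset Set.inter_subset_left

lemma ncard_countedSet {P : ℝ} (hP : 0 ≤ P) :
    (countedSet P).ncard = ∑ s ∈ realSigns, count s ⌊P⌋₊ solubleSet := by
  classical
  have h : countedSet P =
      ((realSigns.biUnion fun s => (box s ⌊P⌋₊).filter (· ∈ solubleSet) :
        Finset (Fin 4 → ℤ)) : Set (Fin 4 → ℤ)) := by
    rw [countedSet_eq_biUnion hP]
    ext x
    simp
  rw [h, Set.ncard_coe_finset, Finset.card_biUnion]
  · exact Finset.sum_congr rfl fun s _ => (count_eq_card_filter s _ _ fun _ => Iff.rfl).symm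
  · intro s _ s' _ hss
    rw [Function.onFun, Finset.disjoint_left]
    intro x hx hx'
    rw [Finset.mem_filter, mem_box_iff] at hx hx'
    refine hss (funext fun i => ?_)
    rw [Bool.eq_iff_iff, ← (hx.1 i).2.2, ← (hx'.1 i).2.2]

/-- The class of an integral vector. -/
noncomputable def classOf (x : Fin 4 → ℤ) (h : Nondegenerate x) : Params :=
  Quot.mk Step ⟨fun i => (x i : ℚ), h.intCast⟩

lemma mem_reducedReps_iff {u : Params} {P : ℝ} {x : Fin 4 → ℤ} :
    x ∈ reducedReps u P ↔
      IsReduced x ∧ (∃ h : Nondegenerate x, classOf x h = u) ∧ ∀ i, |(x i : ℝ)| ≤ P := by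
  simp only [reducedReps, Set.mem_ofPred_eq]
  refine and_congr_right fun hred => and_congr_left fun _ => ?_
  constructor
  · rintro ⟨y, hy, h⟩
    refine ⟨hred.nondegenerate, ?_⟩
    rw [← hy, classOf]
    congr 1
    exact Subtype.ext (funext fun i => (h i).symm)
  · rintro ⟨h, hu⟩
    exact ⟨_, hu, fun _ => rfl⟩

lemma classOf_mem_paramsLoc_iff {x : Fin 4 → ℤ} (h : Nondegenerate x) :
    classOf x h ∈ ParamsLoc ↔ EverywhereLocallySoluble fun i => (x i : ℚ) := by
  constructor
  · rintro ⟨y, hy, hs⟩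
    exact (everywhereLocallySoluble_of_mk_eq hy).1 hs
  · intro hs
    exact ⟨_, rfl, hs⟩

/-- The sets `reducedReps u P` for soluble classes `u` are the fibres of the class map on the finite
set `countedSet P`. Only finitely many classes contribute, so the `finsum` is a genuine sum. -/
lemma Nloc_eq {P : ℝ} (hP : 0 ≤ P) : Nloc P = ((countedSet P).ncard : ℝ) / 4 := by
  classical
  let T := (finite_countedSet hP).toFinset
  have hT : ∀ x, x ∈ T ↔ x ∈ countedSet P := fun x => by simp [T]
  have hnd : ∀ x : T, Nondegenerate x.1 := fun x => ((hT _).1 x.2).1.1.nondegenerate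
  let cls : T → Params := fun x => classOf x.1 (hnd x)
  have hsub : ∀ u ∈ ParamsLoc, ∀ x ∈ reducedReps u P, ∃ h : x ∈ T, cls ⟨x, h⟩ = u := by
    intro u hu x hx
    obtain ⟨hred, ⟨h, rfl⟩, hb⟩ := mem_reducedReps_iff.1 hx
    exact ⟨(hT x).2 ⟨⟨hred, (classOf_mem_paramsLoc_iff h).1 hu⟩, hb⟩, rfl⟩
  have hloc : ∀ x : T, cls x ∈ ParamsLoc := fun x =>
    (classOf_mem_paramsLoc_iff _).2 ((hT _).1 x.2).1.2
  have hfib : ∀ u ∈ ParamsLoc, (reducedReps u P).ncard =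
      (Finset.univ.filter fun x : T => cls x = u).card := by
    intro u hu
    have : reducedReps u P = Subtype.val '' {x : T | cls x = u} := by
      ext x
      constructor
      · intro hx
        obtain ⟨h, hc⟩ := hsub u hu x hx
        exact ⟨⟨x, h⟩, hc, rfl⟩
      · rintro ⟨y, hy, rfl⟩
        have := (hT _).1 y.2
        exact mem_reducedReps_iff.2 ⟨this.1.1, ⟨hnd y, hy⟩, this.2⟩
    rw [this, Set.ncard_image_of_injective _ Subtype.val_injective, ← Set.ncard_coe_finset]
    simp
  have hfin : Nloc P = ∑ u ∈ Finset.univ.image cls, ((reducedReps u P).ncard : ℝ) / 4 := by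
    refine finsum_mem_eq_sum_of_inter_support_eq _ ?_
    ext u
    simp only [Set.mem_inter_iff, Function.mem_support, Finset.coe_image, Finset.coe_univ,
      Set.image_univ, Set.mem_range]
    refine and_congr_left fun hne => ⟨fun hu => ?_, ?_⟩
    · have : (reducedReps u P).Nonempty := by
        by_contra hcon
        rw [Set.not_nonempty_iff_eq_empty] at hcon
        exact hne (by simp [hcon])
      obtain ⟨x, hx⟩ := this
      obtain ⟨h, hc⟩ := hsub u hu x hx
      exact ⟨_, hc⟩
    · rintro ⟨x, rfl⟩
      exact hloc x
  rw [hfin, ← Finset.sum_div]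
  congr 1
  rw [← Nat.cast_sum]
  congr 1
  have hcard : (countedSet P).ncard = (Finset.univ : Finset T).card := by
    rw [Finset.card_univ, Fintype.card_coe, Set.ncard_eq_toFinset_card _ (finite_countedSet hP)]
  rw [hcard, Finset.card_eq_sum_card_image cls]
  refine Finset.sum_congr rfl fun u hu => ?_
  obtain ⟨x, -, rfl⟩ := Finset.mem_image.1 hu
  exact hfib _ (hloc x)

end Chatelet

theorem theorem1 :
    (∀ (p : ℕ) [Fact p.Prime],
      Filter.Tendsto (Chatelet.padicProportion p) Filter.atTop (nhds (Chatelet.tauPrime p))) ∧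
    Chatelet.tauInfinity = 7 / 4 ∧
    Multipliable (fun p : Nat.Primes =>
      (haveI : Fact (p : ℕ).Prime := ⟨p.2⟩; Chatelet.tauPrime (p : ℕ))) ∧
    ∀ ε : ℝ, 0 < ε → ∃ C : ℝ, ∀ P : ℝ, 1 ≤ P →
      |Chatelet.Nloc P - Chatelet.tauLoc * P ^ 4| ≤ C * P ^ (4 - 1 / 8 + ε : ℝ) := by
  refine ⟨fun p _ => Chatelet.tendsto_padicProportion, Chatelet.tauInfinity_eq,
    Chatelet.hasProd_tauPrime.multipliable, fun ε hε => ?_⟩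
  obtain ⟨C, hC⟩ := Chatelet.exists_abs_count_solubleSet_sub_le
  -- Seven admissible orthants, each with error at most `|C| * P ^ (31/8)`, and the weight `1/4`.
  -- The same factor `7/4` in the main term is `tauInfinity`.
  refine ⟨7 / 4 * |C|, fun P hP => ?_⟩
  have hP0 : 0 ≤ P := by linarith
  rw [Chatelet.Nloc_eq hP0, Chatelet.ncard_countedSet hP0, Chatelet.tauLoc,
    Chatelet.tauInfinity_eq]
  set τ := ∏' p : Nat.Primes,
    (haveI : Fact (p : ℕ).Prime := ⟨p.2⟩; Chatelet.tauPrime (p : ℕ)) with hτ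
  have hsplit : ((∑ s ∈ Chatelet.realSigns, Chatelet.count s ⌊P⌋₊ Chatelet.solubleSet : ℕ) : ℝ) / 4
      - 7 / 4 * τ * P ^ 4 = (∑ s ∈ Chatelet.realSigns,
        ((Chatelet.count s ⌊P⌋₊ Chatelet.solubleSet : ℝ) - τ * P ^ 4)) / 4 := by
    rw [Finset.sum_sub_distrib, Finset.sum_const, Chatelet.card_realSigns, nsmul_eq_mul]
    push_cast
    ring
  rw [hsplit, abs_div, abs_of_pos (by norm_num : (0 : ℝ) < 4)]
  have hbound : |∑ s ∈ Chatelet.realSigns,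
      ((Chatelet.count s ⌊P⌋₊ Chatelet.solubleSet : ℝ) - τ * P ^ 4)| ≤
      7 * (|C| * P ^ (4 - 1 / 8 + ε : ℝ)) := by
    refine (Finset.abs_sum_le_sum_abs _ _).trans ?_
    calc _ ≤ ∑ _s ∈ Chatelet.realSigns, |C| * P ^ (4 - 1 / 8 + ε : ℝ) := by
          refine Finset.sum_le_sum fun s _ => (hC s P hP).trans ?_
          refine mul_le_mul (le_abs_self C) ?_ (by positivity) (abs_nonneg C)
          exact Real.rpow_le_rpow_of_exponent_le hP (by linarith)
      _ = _ := by
          rw [Finset.sum_const, Chatelet.card_realSigns, nsmul_eq_mul]; norm_num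
  linarith
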